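/- Let $E$ be a Hausdorff sequentially complete locally convex space over $\mathbb C$, let $L(E)$ be the space of continuous linear operators on $E$ with the topology of uniform convergence on bounded sets, and let $C\in L(E)$ be injective. Let $\alpha\ge 0$ and $\Theta_\alpha(t)=t^\alpha/\Gamma(\alpha+1)$ (so $\Theta_0=1$). Let $A$ be a closed linear operator in $E$ which generates (i.e. is the integral generator of) an $\alpha$-times integrated $C$-semigroup $(S_\alpha(t))_{t\ge0}\subseteq L(E)$. This means that $t\mapsto S_\alpha(t)x$ is continuous on $[0,\infty)$ for all $x\in E$, that $S_\alpha(t)C=CS_\alpha(t)$, $S_\alpha(t)A\subseteq AS_\alpha(t)$, $\int_0^tS_\alpha(s)x\,ds\in D(A)$ and $A\int_0^tS_\alpha(s)x\,ds=S_\alpha(t)x-\Theta_\alpha(t)Cx$ for all $t\ge0$, $x\in E$, and that (the graph of) $A$ equals $$\Bigl\{(x,y)\in E\times E:\ S_\alpha(t)x-\Theta_\alpha(t)Cx=\int_0^tS_\alpha(s)y\,ds\ \text{ for all }t\ge0\Bigr\}.$$ The semigroup is called exponentially equicontinuous if for some $\omega\in\mathbb R$ the family $(e^{-\omega t}S_\alpha(t))_{t\ge0}$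 is equicontinuous, and q-exponentially equicontinuous if for every continuous seminorm $p$ on $E$ there are $M_p\ge1$, $\omega_p\ge0$ and a continuous seminorm $q_p$ on $E$ with $p(S_\alpha(t)x)\le M_pe^{\omega_pt}q_p(x)$ for all $t\ge0$, $x\in E$. Let $\mathcal D=C_c^\infty(\mathbb R)$ with its usual inductive limit topology, let $\mathcal D_0=\{\varphi\in\mathcal D:\operatorname{supp}\varphi\subseteq[0,\infty)\}$, and put $(\varphi*_0\psi)(t)=\int_0^t\varphi(t-s)\psi(s)\,ds$ for $t\in\mathbb R$. A $C$-distribution semigroup is a continuous linear map $\mathcal G:\mathcal D\to L(E)$ which is supported in $[0,\infty)$, commutes with $C$, is boundedly equicontinuous (for every continuous seminorm $p$ on $E$ and bounded $B\subseteq\mathcal D$ there is a continuous seminorm $q$ on $E$ with $p(\mathcal G(\varphi)x)\le q(x)$ for all $\varphi\in B$, $x\in E$), and satisfies $\mathcal G(\varphi*_0\psi)C=\mathcal G(\varphi)\mathcal G(\psi)$ for all $\varphi,\psi\in\mathcal D$ and $\bigcap_{\varphi\in\mathcal D_0}\ker\mathcal G(\varphi)=\{0\}$. Its integral generator is $\{(x,y)\in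 E\times E:\mathcal G(-\varphi')x=\mathcal G(\varphi)y\text{ for all }\varphi\in\mathcal D_0\}$. Write $(e^{-\omega t}\mathcal G)(\varphi)=\mathcal G(e^{-\omega\cdot}\varphi)$. Then $\mathcal G$ is exponential if for some $\omega\in\mathbb R$ the distribution $e^{-\omega t}\mathcal G$ extends to a continuous linear map from the Schwartz space $\mathcal S(\mathbb R)$ to $L(E)$. It is q-exponential if for every continuous seminorm $p$ on $E$ there is $\omega_p\ge0$ such that for every bounded $B\subseteq E$ there are $M\ge1$ and a continuous seminorm $q$ on $\mathcal S(\mathbb R)$ with $\sup_{x\in B}p\bigl((e^{-\omega_pt}\mathcal G)(\varphi)x\bigr)\le M\,q(\varphi)$ for all $\varphi\in\mathcal D$. For $\varphi\in\mathcal D$ and $n=\lceil\alpha\rceil$ let $W_+^\alpha\varphi=(-1)^n\varphi^{(n)}$ if $\alpha=n$, and otherwise $$W_+^\alpha\varphi(t)=\frac{(-1)^n}{\Gamma(n-\alpha)}\frac{d^n}{dt^n}\int_t^\infty(s-t)^{n-\alpha-1}\varphi(s)\,ds,\qquad t\in\mathbb R .$$ **Theorem.** If $(S_\alpha(t))_{t\ge0}$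 is exponentially equicontinuous (respectively, q-exponentially equicontinuous), then $$\mathcal G_\alpha(\varphi)x:=\int_0^\infty W_+^\alpha\varphi(t)\,S_\alpha(t)x\,dt,\qquad \varphi\in\mathcal D,\ x\in E,$$ defines an exponential (respectively, q-exponential) $C$-distribution semigroup $\mathcal G_\alpha$, and $A$ is the integral generator of $\mathcal G_\alpha$. -/

import Mathlib

open MeasureTheory Set Filter Topology TopologicalSpace
open scoped Distributions SchwartzMap

noncomputable section

namespace CDist

/-! ### Test functions on the real line -/

/-- The space `𝓓 = C_c^∞(ℝ)` of complex valued test functions, with its usual locally convex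
inductive limit topology (as provided by Mathlib). -/
abbrev TestFn : Type := 𝓓((⊤ : Opens ℝ), ℂ)

/-- `𝓓₀`: the test functions supported in `[0, ∞)`. -/
def TestFn₀ : Set TestFn := {φ | tsupport φ ⊆ Ici (0 : ℝ)}

/-- The derivative `φ'` of a test function. -/
def derivTest (φ : TestFn) : TestFn where
  toFun := deriv φ
  contDiff' := (contDiff_infty_iff_deriv.1 φ.contDiff).2
  hasCompactSupport' := φ.hasCompactSupport.deriv
  tsupport_subset' := fun _ _ => trivial

/-- The test function `t ↦ e^{ω t} φ(t)`. -/
def expMul (ω : ℝ) (φ : TestFn) : TestFn where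
  toFun := fun t => (Real.exp (ω * t) : ℂ) * φ t
  contDiff' := by
    refine ContDiff.mul ?_ φ.contDiff
    exact Complex.ofRealCLM.contDiff.comp (Real.contDiff_exp.comp (contDiff_const.mul contDiff_id))
  hasCompactSupport' := φ.hasCompactSupport.mul_left
  tsupport_subset' := fun _ _ => trivial

/-- A test function, seen as a Schwartz function. -/
def toSchwartz (φ : TestFn) : 𝓢(ℝ, ℂ) :=
  φ.hasCompactSupport.toSchwartzMap φ.contDiff

/-- The function `(φ *₀ ψ)(t) = ∫_0^t φ(t - s) ψ(s) ds`, `t ∈ ℝ` (oriented integral). -/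
def conv₀Fun (φ ψ : ℝ → ℂ) (t : ℝ) : ℂ := ∫ s in (0 : ℝ)..t, φ (t - s) * ψ s

/-- `φ *₀ ψ` is a difference of two ordinary convolutions, each having one factor which is a test
function and another one which is a truncated test function. -/
theorem conv₀Fun_eq (φ ψ : TestFn) :
    conv₀Fun φ ψ =
      convolution ((Ioi (0 : ℝ)).indicator ψ) φ (ContinuousLinearMap.mul ℝ ℂ) volume -
      convolution ψ ((Iio (0 : ℝ)).indicator φ) (ContinuousLinearMap.mul ℝ ℂ) volume := by
  funext t
  have hint : Integrable (fun s => φ (t - s) * ψ s) volume := by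
    refine Continuous.integrable_of_hasCompactSupport ?_ ?_
    · exact (φ.continuous.comp (continuous_const.sub continuous_id)).mul ψ.continuous
    · exact ψ.hasCompactSupport.mul_left
  have h1 : convolution ((Ioi (0 : ℝ)).indicator ψ) φ (ContinuousLinearMap.mul ℝ ℂ) volume t
      = ∫ s in Ioi (0 : ℝ), φ (t - s) * ψ s := by
    rw [convolution_def, ← integral_indicator measurableSet_Ioi]
    congr 1
    funext s
    by_cases hs : s ∈ Ioi (0 : ℝ)
    · simp [indicator_of_mem hs, mul_comm]
    · simp [indicator_of_notMem hs]
  have h2 : convolution ψ ((Iio (0 : ℝ)).indicator φ) (ContinuousLinearMap.mul ℝ ℂ) volume t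
      = ∫ s in Ioi t, φ (t - s) * ψ s := by
    rw [convolution_def, ← integral_indicator measurableSet_Ioi]
    congr 1
    funext s
    by_cases hs : t < s
    · have h3 : t - s ∈ Iio (0 : ℝ) := by simpa using hs
      rw [indicator_of_mem h3, indicator_of_mem (mem_Ioi.2 hs)]
      simp [mul_comm]
    · have h3 : t - s ∉ Iio (0 : ℝ) := by simpa using hs
      rw [indicator_of_notMem h3, indicator_of_notMem (by simpa using hs)]
      simp
  rw [Pi.sub_apply, h1, h2, conv₀Fun]
  exact (intervalIntegral.integral_Ioi_sub_Ioi' hint.integrableOn hint.integrableOn).symm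

theorem integrable_testFn (φ : TestFn) : Integrable (φ : ℝ → ℂ) volume :=
  φ.continuous.integrable_of_hasCompactSupport φ.hasCompactSupport

theorem hasCompactSupport_indicator (φ : TestFn) (s : Set ℝ) :
    HasCompactSupport (s.indicator (φ : ℝ → ℂ)) :=
  φ.hasCompactSupport.mono (by
    intro x hx h
    exact hx (by by_cases hs : x ∈ s <;> simp [hs, h]))

/-- The test function `φ *₀ ψ`. -/
def conv₀ (φ ψ : TestFn) : TestFn where
  toFun := conv₀Fun φ ψ
  contDiff' := by
    rw [conv₀Fun_eq]
    refine ContDiff.sub ?_ ?_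
    · exact φ.hasCompactSupport.contDiff_convolution_right _
        ((integrable_testFn ψ).indicator measurableSet_Ioi).locallyIntegrable φ.contDiff
    · exact ψ.hasCompactSupport.contDiff_convolution_left _ ψ.contDiff
        ((integrable_testFn φ).indicator measurableSet_Iio).locallyIntegrable
  hasCompactSupport' := by
    rw [conv₀Fun_eq]
    refine HasCompactSupport.sub ?_ ?_
    · exact (hasCompactSupport_indicator ψ _).convolution _ φ.hasCompactSupport
    · exact ψ.hasCompactSupport.convolution _ (hasCompactSupport_indicator φ _)
  tsupport_subset' := fun _ _ => trivial

/-! ### The Weyl fractional derivative -/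

/-- The Weyl fractional derivative `W_+^α f`, `α ≥ 0`. With `n = ⌈α⌉` it is `(-1)^n f^{(n)}` when
`α = n` is an integer, and otherwise
`(-1)^n / Γ(n - α) * d^n/dt^n ∫_t^∞ (s - t)^{n - α - 1} f(s) ds`. -/
def weylDeriv (α : ℝ) (f : ℝ → ℂ) (t : ℝ) : ℂ :=
  open scoped Classical in
  if (⌈α⌉₊ : ℝ) = α then (-1 : ℂ) ^ ⌈α⌉₊ * iteratedDeriv ⌈α⌉₊ f t
  else (-1 : ℂ) ^ ⌈α⌉₊ / (Real.Gamma (⌈α⌉₊ - α) : ℂ) *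
    iteratedDeriv ⌈α⌉₊ (fun r : ℝ => ∫ s in Ioi r, (((s - r) ^ ((⌈α⌉₊ : ℝ) - α - 1) : ℝ) : ℂ) * f s) t

/-! ### Locally convex spaces -/

/-- Every Cauchy sequence converges. -/
def SeqComplete (E : Type*) [UniformSpace E] : Prop :=
  ∀ u : ℕ → E, CauchySeq u → ∃ x, Tendsto u atTop (𝓝 x)

variable {E : Type*} [AddCommGroup E] [Module ℂ E] [UniformSpace E]

/-- `y = ∫_s f(t) dt` for a vector valued function `f` on `s ⊆ ℝ` (Lebesgue measure): every
continuous linear functional `ℓ` is integrable along `f` on `s`, with `ℓ y = ∫_s ℓ (f t) dt`.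
In a Hausdorff locally convex space there is at most one such `y`. -/
def HasIntegralOn (f : ℝ → E) (s : Set ℝ) (y : E) : Prop :=
  ∀ ℓ : E →L[ℂ] ℂ, IntegrableOn (fun t => ℓ (f t)) s ∧ ∫ t in s, ℓ (f t) = ℓ y

/-! ### Integrated `C`-semigroups -/

/-- `Θ_α(t) = t^α / Γ(α + 1)`; in particular `Θ_0(t) = 1` for every `t ≥ 0`. -/
def Theta (α t : ℝ) : ℂ := ((t ^ α / Real.Gamma (α + 1) : ℝ) : ℂ)

/-- `(S(t))_{t ≥ 0}` is an `α`-times integrated `C`-semigroup with subgenerator `A`. Only the values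
of `S` on `[0, ∞)` matter. -/
structure IsSubgenerator (C : E →L[ℂ] E) (α : ℝ) (S : ℝ → E →L[ℂ] E) (A : E →ₗ.[ℂ] E) : Prop where
  closed : A.IsClosed
  /-- `(S(t))` is strongly continuous. -/
  continuousOn : ∀ x, ContinuousOn (fun t => S t x) (Ici 0)
  /-- `S(t) C = C S(t)`. -/
  comm : ∀ t, 0 ≤ t → ∀ x, S t (C x) = C (S t x)
  /-- `S(t) A ⊆ A S(t)`. -/
  comm_op : ∀ t, 0 ≤ t → ∀ x y, (x, y) ∈ A.graph → (S t x, S t y) ∈ A.graph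
  /-- `A ∫_0^t S(s) x ds = S(t) x - Θ_α(t) C x`. -/
  eq_op : ∀ t, 0 ≤ t → ∀ x, ∃ z, HasIntegralOn (fun s => S s x) (Ioc 0 t) z ∧
    (z, S t x - Theta α t • C x) ∈ A.graph

/-- The integral generator of an `α`-times integrated `C`-semigroup (as a graph): the pairs `(x, y)`
with `S(t) x - Θ_α(t) C x = ∫_0^t S(s) y ds` for all `t ≥ 0`. -/
def semigroupIntegralGenerator (C : E →L[ℂ] E) (α : ℝ) (S : ℝ → E →L[ℂ] E) : Set (E × E) :=
  {z | ∀ t, 0 ≤ t → HasIntegralOn (fun s => S s z.2) (Ioc 0 t) (S t z.1 - Theta α t • C z.1)}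

/-- `A` generates the `α`-times integrated `C`-semigroup `(S(t))_{t ≥ 0}`, i.e. it is its integral
generator. -/
def Generates (C : E →L[ℂ] E) (α : ℝ) (S : ℝ → E →L[ℂ] E) (A : E →ₗ.[ℂ] E) : Prop :=
  IsSubgenerator C α S A ∧ (A.graph : Set (E × E)) = semigroupIntegralGenerator C α S

/-- Exponential equicontinuity: for some `ω`, the family `(e^{-ω t} S(t))_{t ≥ 0}` is
equicontinuous. -/
def ExpEquicontinuous (S : ℝ → E →L[ℂ] E) : Prop :=
  ∃ ω : ℝ, ∀ p : Seminorm ℂ E, Continuous p → ∃ q : Seminorm ℂ E, Continuous q ∧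
    ∀ t, 0 ≤ t → ∀ x, p (S t x) ≤ Real.exp (ω * t) * q x

/-- Quasi-exponential equicontinuity: the exponential type may depend on the seminorm. -/
def QExpEquicontinuous (S : ℝ → E →L[ℂ] E) : Prop :=
  ∀ p : Seminorm ℂ E, Continuous p → ∃ M : ℝ, 1 ≤ M ∧ ∃ ω : ℝ, 0 ≤ ω ∧
    ∃ q : Seminorm ℂ E, Continuous q ∧
      ∀ t, 0 ≤ t → ∀ x, p (S t x) ≤ M * Real.exp (ω * t) * q x

/-! ### `C`-distribution semigroups

`E →L[ℂ] E` carries the topology of uniform convergence on bounded sets. -/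

variable [IsUniformAddGroup E] [ContinuousSMul ℂ E]

/-- `G` is a `C`-distribution semigroup: an `L(E)`-valued distribution supported in `[0, ∞)` that
commutes with `C`, is boundedly equicontinuous, satisfies `G(φ *₀ ψ) C = G(φ) G(ψ)`, and is
nondegenerate. -/
structure IsDistributionSemigroup (C : E →L[ℂ] E) (G : TestFn →L[ℂ] E →L[ℂ] E) : Prop where
  /-- `G` vanishes on test functions supported in `(-∞, 0)`. -/
  support : ∀ φ : TestFn, tsupport φ ⊆ Iio (0 : ℝ) → G φ = 0
  comm : ∀ φ x, G φ (C x) = C (G φ x)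
  bddEquicontinuous : ∀ p : Seminorm ℂ E, Continuous p →
    ∀ B : Set TestFn, Bornology.IsVonNBounded ℂ B →
      ∃ q : Seminorm ℂ E, Continuous q ∧ ∀ φ ∈ B, ∀ x, p (G φ x) ≤ q x
  conv : ∀ φ ψ x, G (conv₀ φ ψ) (C x) = G φ (G ψ x)
  nondegenerate : ∀ x, (∀ φ ∈ TestFn₀, G φ x = 0) → x = 0

/-- The integral generator of `G` (as a graph): the pairs `(x, y)` with `G(-φ') x = G(φ) y` for
all `φ ∈ 𝓓₀`. -/
def distributionIntegralGenerator (G : TestFn →L[ℂ] E →L[ℂ] E) : Set (E × E) :=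
  {z | ∀ φ ∈ TestFn₀, G (-derivTest φ) z.1 = G φ z.2}

/-- `G` is exponential: for some `ω`, the distribution `e^{-ω t} G`, that is
`φ ↦ G(e^{-ω t} φ)`, is (the restriction to `𝓓` of) a tempered `L(E)`-valued distribution. -/
def IsExponential (G : TestFn →L[ℂ] E →L[ℂ] E) : Prop :=
  ∃ ω : ℝ, ∃ H : 𝓢(ℝ, ℂ) →L[ℂ] E →L[ℂ] E,
    ∀ φ : TestFn, H (toSchwartz φ) = G (expMul (-ω) φ)

/-- `G` is quasi-equicontinuous exponential: for each continuous seminorm `p` there is `ω ≥ 0` such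
that `e^{-ω t} G` satisfies, uniformly on each bounded subset of `E`, an estimate in the seminorm
`p` by a continuous seminorm of the Schwartz space. -/
def IsQExponential (G : TestFn →L[ℂ] E →L[ℂ] E) : Prop :=
  ∀ p : Seminorm ℂ E, Continuous p → ∃ ω : ℝ, 0 ≤ ω ∧
    ∀ B : Set E, Bornology.IsVonNBounded ℂ B →
      ∃ M : ℝ, 1 ≤ M ∧ ∃ q : Seminorm ℂ 𝓢(ℝ, ℂ), Continuous q ∧
        ∀ φ : TestFn, ∀ x ∈ B, p (G (expMul (-ω) φ) x) ≤ M * q (toSchwartz φ)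

end CDist

end

/-! Write `n = ⌈α⌉` and let `κ` be the measure `weylMeasure α`: a point mass at 0 if `α = n`,
otherwise the density `u^(n-α-1)/Γ(n-α)` on `(0, ∞)`. Differentiating under the integral turns
`W_+^α φ` into the average of `(-1)^n φ^{(n)}(t + u)` over `κ` (`weylDeriv_eq`). Exponential decay
of `φ^{(n)}` passes to this average at the same rate, so decay of rate `ω + 1` beats growth of rate
`ω` of the semigroup. This gives existence of the integrals, continuity of `G` and both exponential
estimates; the integrals are weak ones, realised as limits of Riemann sums by sequential
completeness.

The algebra rests on one identity, `distribution_mem_graph`: `A G(φ)x = -G(φ')x - φ(0)Cx`. It comes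
from integration by parts, `A ∫_0^t S x = S(t)x - Θ_α(t)Cx`, the closedness of `A`, and `∫ Θ_α W_+^α
φ' = -φ(0)`, which is Euler's beta integral followed by `n + 1` integrations by parts.

Convolution law: for fixed `x` put `B(φ, ψ) = G(φ *₀ ψ)Cx - G(φ)G(ψ)x`. The identity, used on either
factor, gives `B(φ', ψ) = B(φ, ψ')`, so `B(φ(· + h), ψ(· - h))` does not depend on `h`. For large
`h` the first argument vanishes on `[0, ∞)`, where `B` is zero; hence `B = 0` (`bilinear_eq_zero`).

Generator: that `A` is contained in the generator of `G` is immediate from the identity. Conversely,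
if `(x, y)` is in the generator of `G`, then `v(φ) = -G(φ')x - φ(0)Cx - G(φ)y` is supported at the
origin and has finite order, so it kills high powers of `t` (localised by a cutoff). Since `A` is
single valued, the identity lets `v(t^(k+1)) = 0` imply `v(t^k) = 0`; descending to `k = 0` yields
`(Cx, Cy) ∈ A`, and the integral generator satisfies `C⁻¹AC = A`. Nondegeneracy follows, as `(0, x)`
in the generator forces `x = 0`. -/

noncomputable section

namespace CDist

/-! ### Hahn–Banach consequences and representation of functionals on the dual. -/

section FunctionalAnalysis

variable {E : Type*} [AddCommGroup E] [Module ℂ E] [UniformSpace E]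

theorem exists_functional_eq_seminorm [PolynormableSpace ℂ E] {p : Seminorm ℂ E}
    (hp : Continuous p) (y : E) :
    ∃ ℓ : E →L[ℂ] ℂ, (∀ x, ‖ℓ x‖ ≤ p x) ∧ ‖ℓ y‖ = p y := by
  by_cases hy : y = 0
  · exact ⟨0, fun x => by simp, by simp [hy]⟩
  let f : Module.Dual ℂ (ℂ ∙ y) :=
    (p y : ℂ) • (LinearEquiv.toSpanNonzeroSingleton ℂ E y hy).symm.toLinearMap
  have hf : ∀ c : ℂ, f ⟨c • y, Submodule.smul_mem _ _ (Submodule.mem_span_singleton_self y)⟩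
      = p y * c := by
    intro c
    have : (⟨c • y, Submodule.smul_mem _ _ (Submodule.mem_span_singleton_self y)⟩ : ℂ ∙ y)
        = LinearEquiv.toSpanNonzeroSingleton ℂ E y hy c := rfl
    simp only [f, this, LinearMap.smul_apply, LinearEquiv.coe_coe, LinearEquiv.symm_apply_apply,
      smul_eq_mul]
  obtain ⟨g, hg, hle⟩ := Module.Dual.exists_continuous_extension_of_le_seminorm (ℂ ∙ y) f hp (by
    rintro ⟨x, hx⟩
    obtain ⟨c, rfl⟩ := Submodule.mem_span_singleton.1 hx
    rw [hf]
    simp [map_smul_eq_mul, mul_comm, abs_of_nonneg (apply_nonneg p y)])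
  refine ⟨g, hle, ?_⟩
  have h1 := hg ⟨(1 : ℂ) • y, Submodule.smul_mem _ _ (Submodule.mem_span_singleton_self y)⟩
  rw [hf] at h1
  simp only [one_smul, mul_one] at h1
  rw [h1]
  simp [abs_of_nonneg (apply_nonneg p y)]

theorem seminorm_le_of_functional_le [PolynormableSpace ℂ E] {p : Seminorm ℂ E}
    (hp : Continuous p) {y : E} {c : ℝ}
    (h : ∀ ℓ : E →L[ℂ] ℂ, (∀ x, ‖ℓ x‖ ≤ p x) → ‖ℓ y‖ ≤ c) : p y ≤ c := by
  obtain ⟨ℓ, h1, h2⟩ := exists_functional_eq_seminorm hp y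
  exact h2 ▸ h ℓ h1

theorem eq_zero_of_seminorm_eq_zero [PolynormableSpace ℂ E] [T2Space E] {y : E}
    (h : ∀ p : Seminorm ℂ E, Continuous p → p y = 0) : y = 0 := by
  by_contra hy
  have := (PolynormableSpace.withSeminorms ℂ E).separating_of_T1 y hy
  obtain ⟨⟨p, hp⟩, hpy⟩ := this
  exact hpy (h p hp)

theorem eq_of_functional_eq [PolynormableSpace ℂ E] [T2Space E] {y z : E}
    (h : ∀ ℓ : E →L[ℂ] ℂ, ℓ y = ℓ z) : y = z := by
  rw [← sub_eq_zero]
  refine eq_zero_of_seminorm_eq_zero fun p hp => ?_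
  obtain ⟨ℓ, -, h2⟩ := exists_functional_eq_seminorm hp (y - z)
  rw [← h2, map_sub, h ℓ, sub_self, norm_zero]

theorem locallyConvexSpace_of_polynormable [PolynormableSpace ℂ E] [IsUniformAddGroup E] :
    LocallyConvexSpace ℝ E :=
  (PolynormableSpace.withSeminorms ℂ E).toLocallyConvexSpace

/-- The continuous seminorm `x ↦ ‖ℓ x‖`. -/
def functionalSeminorm (ℓ : E →L[ℂ] ℂ) : Seminorm ℂ E :=
  (normSeminorm ℂ ℂ).comp ℓ.toLinearMap

@[simp] theorem functionalSeminorm_apply (ℓ : E →L[ℂ] ℂ) (x : E) :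
    functionalSeminorm ℓ x = ‖ℓ x‖ := rfl

theorem continuous_functionalSeminorm (ℓ : E →L[ℂ] ℂ) : Continuous (functionalSeminorm ℓ) :=
  ℓ.continuous.norm

theorem continuous_const_smul_seminorm {F : Type*} [AddCommGroup F] [Module ℂ F]
    [TopologicalSpace F] {q : Seminorm ℂ F} (hq : Continuous q) (c : NNReal) :
    Continuous (c • q) := by
  change Continuous (fun x => c • q x)
  exact continuous_const.smul hq

theorem bounded_on_of_isVonNBounded {F : Type*} [AddCommGroup F] [Module ℂ F] [TopologicalSpace F]
    {B : Set F} (hB : Bornology.IsVonNBounded ℂ B) {q : Seminorm ℂ F} (hq : Continuous q) :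
    ∃ M : ℝ, 0 ≤ M ∧ ∀ x ∈ B, q x ≤ M := by
  have h0 : q.ball 0 1 ∈ 𝓝 (0 : F) := by
    have : q.ball 0 1 = q ⁻¹' Iio 1 := by ext x; simp [Seminorm.mem_ball]
    rw [this]
    exact hq.continuousAt.preimage_mem_nhds (by simpa using Iio_mem_nhds one_pos)
  obtain ⟨r, hr0, hr⟩ := (hB h0).exists_pos
  refine ⟨r, hr0.le, fun x hx => ?_⟩
  have := hr (r : ℂ) (by simp [abs_of_pos hr0]) hx
  obtain ⟨z, hz, rfl⟩ := this
  have hz : q z < 1 := by simpa [Seminorm.mem_ball] using hz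
  simp only [map_smul_eq_mul]
  simp only [Complex.norm_real, Real.norm_eq_abs, abs_of_pos hr0]
  nlinarith

/-- A functional on the dual which is approximated, uniformly on polars of neighbourhoods of zero,
by a sequence of points of a sequentially complete space is represented by a point. -/
theorem SeqComplete.exists_of_functional_approx [PolynormableSpace ℂ E] [IsUniformAddGroup E]
    (hE : SeqComplete E) (c : (E →L[ℂ] ℂ) → ℂ) (y : ℕ → E)
    (h : ∀ p : Seminorm ℂ E, Continuous p → ∃ ε : ℕ → ℝ, Tendsto ε atTop (𝓝 0) ∧
      ∀ N, ∀ ℓ : E →L[ℂ] ℂ, (∀ x, ‖ℓ x‖ ≤ p x) → ‖ℓ (y N) - c ℓ‖ ≤ ε N) :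
    ∃ z, ∀ ℓ, ℓ z = c ℓ := by
  have hc : CauchySeq y := by
    rw [cauchySeq_iff_tendsto, uniformity_eq_comap_nhds_zero, tendsto_comap_iff,
      -- By Hahn–Banach, `p` is the supremum of `‖ℓ ·‖` over the functionals dominated by `p`, so a
      -- bound uniform in these `ℓ` is a bound for `p (y n - y m)`.
      (PolynormableSpace.withSeminorms ℂ E).tendsto_nhds _ 0]
    rintro ⟨p, hp⟩ ε hε
    obtain ⟨e, he, hle⟩ := h p hp
    have h1 : ∀ᶠ n in atTop, e n < ε / 2 := he.eventually_lt_const (by positivity)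
    rw [← prod_atTop_atTop_eq]
    filter_upwards [h1.prod_mk h1] with ⟨m, n⟩ ⟨hm, hn⟩
    refine lt_of_le_of_lt (b := e m + e n) ?_ (by simp only at hm hn; linarith)
    refine seminorm_le_of_functional_le hp fun ℓ hℓ => ?_
    simp only [Function.comp, Prod.map, sub_zero, map_sub]
    calc ‖ℓ (y n) - ℓ (y m)‖ = ‖(ℓ (y n) - c ℓ) - (ℓ (y m) - c ℓ)‖ := by congr 1; ring
      _ ≤ ‖ℓ (y n) - c ℓ‖ + ‖ℓ (y m) - c ℓ‖ := norm_sub_le _ _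
      _ ≤ e m + e n := by have := hle n ℓ hℓ; have := hle m ℓ hℓ; linarith
  obtain ⟨z, hz⟩ := hE y hc
  refine ⟨z, fun ℓ => ?_⟩
  obtain ⟨e, he, hle⟩ := h _ (continuous_functionalSeminorm ℓ)
  refine tendsto_nhds_unique ((ℓ.continuous.tendsto z).comp hz) ?_
  rw [tendsto_iff_norm_sub_tendsto_zero]
  exact squeeze_zero (fun _ => norm_nonneg _) (fun N => hle N ℓ fun x => le_rfl) he

/-- A closed subspace of `E × E` is the annihilator of its annihilator. This reduces closedness of
`A` to scalar identities, the form in which weak integrals can be handled. -/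
theorem mem_graph_of_functional [PolynormableSpace ℂ E] [IsUniformAddGroup E] [ContinuousSMul ℂ E]
    {A : E →ₗ.[ℂ] E} (hA : A.IsClosed) {z : E × E}
    (h : ∀ ℓ₁ ℓ₂ : E →L[ℂ] ℂ, (∀ w ∈ A.graph, ℓ₁ w.1 + ℓ₂ w.2 = 0) → ℓ₁ z.1 + ℓ₂ z.2 = 0) :
    z ∈ A.graph := by
  have : LocallyConvexSpace ℝ E := locallyConvexSpace_of_polynormable
  by_contra hz
  have hconv : Convex ℝ (A.graph : Set (E × E)) := (A.graph.restrictScalars ℝ).convex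
  obtain ⟨f, u, h1, h2⟩ := RCLike.geometric_hahn_banach_point_closed (𝕜 := ℂ) hconv hA hz
  have hf : ∀ w ∈ A.graph, f w = 0 := by
    intro w hw
    by_contra hne
    -- This multiple of `w` is chosen so that `f` takes the value `u - 1` on it, although `u` is a
    -- strict lower bound for `re f` on the graph.
    have hc := h2 ((((u - 1 : ℝ) : ℂ) * (f w)⁻¹) • w) (A.graph.smul_mem _ hw)
    have hfw : f ((((u - 1 : ℝ) : ℂ) * (f w)⁻¹) • w) = ((u - 1 : ℝ) : ℂ) := by
      rw [map_smul, smul_eq_mul, mul_assoc, inv_mul_cancel₀ hne, mul_one]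
    rw [hfw] at hc
    simp at hc
    linarith
  have h3 := h (f.comp (ContinuousLinearMap.inl ℂ E E)) (f.comp (ContinuousLinearMap.inr ℂ E E)) (by
    intro w hw
    rw [← hf w hw]
    simp only [ContinuousLinearMap.comp_apply, ContinuousLinearMap.inl_apply,
      ContinuousLinearMap.inr_apply, ← map_add]
    simp)
  have h4 : f z = 0 := by
    rw [← h3]
    simp only [ContinuousLinearMap.comp_apply, ContinuousLinearMap.inl_apply,
      ContinuousLinearMap.inr_apply, ← map_add]
    simp
  have h5 := h2 0 A.graph.zero_mem
  rw [h4] at h1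
  simp at h1 h5
  linarith

end FunctionalAnalysis

/-! ### Calculus of weak integrals. -/

section WeakIntegral

variable {E : Type*} [AddCommGroup E] [Module ℂ E] [UniformSpace E]

theorem HasIntegralOn.unique [PolynormableSpace ℂ E] [T2Space E] {f : ℝ → E} {s : Set ℝ} {y z : E}
    (hy : HasIntegralOn f s y) (hz : HasIntegralOn f s z) : y = z :=
  eq_of_functional_eq fun ℓ => by rw [← (hy ℓ).2, ← (hz ℓ).2]

theorem HasIntegralOn.congr {f g : ℝ → E} {s : Set ℝ} {y : E} (hs : MeasurableSet s)
    (hy : HasIntegralOn f s y) (h : ∀ t ∈ s, f t = g t) : HasIntegralOn g s y := by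
  intro ℓ
  have h' : EqOn (fun t => ℓ (f t)) (fun t => ℓ (g t)) s := fun t ht => by simp [h t ht]
  exact ⟨(hy ℓ).1.congr_fun h' hs, by rw [← (hy ℓ).2, setIntegral_congr_fun hs h']⟩

theorem HasIntegralOn.add {f g : ℝ → E} {s : Set ℝ} {y z : E} (hy : HasIntegralOn f s y)
    (hz : HasIntegralOn g s z) : HasIntegralOn (fun t => f t + g t) s (y + z) := by
  intro ℓ
  simp only [map_add]
  exact ⟨(hy ℓ).1.add (hz ℓ).1, by
    rw [integral_add (hy ℓ).1 (hz ℓ).1, (hy ℓ).2, (hz ℓ).2]⟩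

theorem HasIntegralOn.const_smul {f : ℝ → E} {s : Set ℝ} {y : E} (c : ℂ) (hy : HasIntegralOn f s y) :
    HasIntegralOn (fun t => c • f t) s (c • y) := by
  intro ℓ
  simp only [map_smul]
  exact ⟨(hy ℓ).1.smul c, by rw [integral_smul, (hy ℓ).2]⟩

theorem HasIntegralOn.sub {f g : ℝ → E} {s : Set ℝ} {y z : E} (hy : HasIntegralOn f s y)
    (hz : HasIntegralOn g s z) : HasIntegralOn (fun t => f t - g t) s (y - z) := by
  simpa [sub_eq_add_neg] using hy.add (hz.const_smul (-1))

theorem HasIntegralOn.map {f : ℝ → E} {s : Set ℝ} {y : E} (T : E →L[ℂ] E)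
    (hy : HasIntegralOn f s y) : HasIntegralOn (fun t => T (f t)) s (T y) :=
  fun ℓ => hy (ℓ.comp T)

theorem HasIntegralOn.seminorm_le [PolynormableSpace ℂ E] {f : ℝ → E} {s : Set ℝ} {y : E}
    (hs : MeasurableSet s) (hy : HasIntegralOn f s y) {p : Seminorm ℂ E} (hp : Continuous p)
    {g : ℝ → ℝ} (hg : IntegrableOn g s) (hfg : ∀ t ∈ s, p (f t) ≤ g t) :
    p y ≤ ∫ t in s, g t := by
  refine seminorm_le_of_functional_le hp fun ℓ hℓ => ?_
  rw [← (hy ℓ).2]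
  refine norm_integral_le_of_norm_le hg ?_
  filter_upwards [ae_restrict_mem hs] with t ht
  exact (hℓ _).trans (hfg t ht)

/-- Closed operators pass through weak integrals: a pair of functionals annihilating the graph
annihilates the integrand pointwise, hence the pair of integrals. -/
theorem HasIntegralOn.mem_graph [PolynormableSpace ℂ E] [IsUniformAddGroup E]
    [ContinuousSMul ℂ E] {A : E →ₗ.[ℂ] E} (hA : A.IsClosed) {f g : ℝ → E} {s : Set ℝ} {y z : E}
    (hy : HasIntegralOn f s y) (hz : HasIntegralOn g s z)
    (h : ∀ t ∈ s, (f t, g t) ∈ A.graph) : (y, z) ∈ A.graph := by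
  refine mem_graph_of_functional hA fun ℓ₁ ℓ₂ hℓ => ?_
  simp only
  rw [← (hy ℓ₁).2, ← (hz ℓ₂).2, ← integral_add (hy ℓ₁).1 (hz ℓ₂).1]
  exact setIntegral_eq_zero_of_forall_eq_zero fun t ht => hℓ _ (h t ht)

end WeakIntegral

/-! ### Existence of integrals over the half-line by Riemann sums. -/

section ImproperIntegral

theorem floor_div_eq_iff {δ t : ℝ} (hδ : 0 < δ) (ht : 0 ≤ t) (k : ℕ) :
    ⌊t / δ⌋₊ = k ↔ t ∈ Ico (k * δ) ((k + 1) * δ) := by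
  rw [Nat.floor_eq_iff (by positivity), le_div_iff₀ hδ, div_lt_iff₀ hδ, mem_Ico]

/-- Writing a Riemann sum as the integral of a step function makes its error an integral too, to
which dominated convergence applies. -/
theorem step_integral {δ : ℝ} (hδ : 0 < δ) (M : ℕ) (g : ℕ → ℂ) :
    IntegrableOn (fun t : ℝ => if ⌊t / δ⌋₊ < M then g ⌊t / δ⌋₊ else 0) (Ioi 0) ∧
    ∫ t in Ioi (0 : ℝ), (if ⌊t / δ⌋₊ < M then g ⌊t / δ⌋₊ else 0) =
      ∑ k ∈ Finset.range M, (δ : ℂ) * g k := by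
  have hsub : ∀ k : ℕ, Ico (k * δ) ((k + 1) * δ) ⊆ Ici (0 : ℝ) := fun k t ht =>
    le_trans (by positivity) ht.1
  have heq : EqOn (fun t : ℝ => if ⌊t / δ⌋₊ < M then g ⌊t / δ⌋₊ else 0)
      (fun t => ∑ k ∈ Finset.range M, (Ico (k * δ) ((k + 1) * δ)).indicator (fun _ => g k) t)
      (Ici 0) := by
    intro t ht
    have hind : ∀ k ∈ Finset.range M, (Ico (k * δ) ((k + 1) * δ)).indicator (fun _ => g k) t =
        if k = ⌊t / δ⌋₊ then g k else 0 := by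
      intro k _
      by_cases h : t ∈ Ico (k * δ) ((k + 1) * δ)
      · rw [indicator_of_mem h, if_pos ((floor_div_eq_iff hδ ht k).2 h).symm]
      · rw [indicator_of_notMem h, if_neg fun h' => h ((floor_div_eq_iff hδ ht k).1 h'.symm)]
    simp only
    rw [Finset.sum_congr rfl hind, Finset.sum_ite_eq']
    simp
  have hint : ∀ k : ℕ, IntegrableOn ((Ico (k * δ) ((k + 1) * δ)).indicator (fun _ => g k))
      (Ici (0 : ℝ)) := by
    intro k
    refine (Integrable.integrableOn ?_)
    rw [integrable_indicator_iff measurableSet_Ico]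
    exact integrableOn_const (by simp)
  have hint' : IntegrableOn (fun t => ∑ k ∈ Finset.range M,
      (Ico (k * δ) ((k + 1) * δ)).indicator (fun _ => g k) t) (Ici (0 : ℝ)) :=
    integrable_finsetSum _ fun k _ => hint k
  refine ⟨(hint'.congr_fun heq.symm measurableSet_Ici).mono_set Ioi_subset_Ici_self, ?_⟩
  rw [← integral_Ici_eq_integral_Ioi, setIntegral_congr_fun measurableSet_Ici heq,
    integral_finsetSum _ fun k _ => hint k]
  refine Finset.sum_congr rfl fun k _ => ?_
  rw [setIntegral_indicator measurableSet_Ico, inter_eq_self_of_subset_right (hsub k),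
    setIntegral_const]
  simp only [measureReal_def, Real.volume_Ico]
  rw [ENNReal.toReal_ofReal (by nlinarith)]
  rw [Complex.real_smul]
  congr 2
  ring

theorem integrableOn_exp_neg_mul {ω : ℝ} (hω : 0 < ω) :
    IntegrableOn (fun t : ℝ => Real.exp (-ω * t)) (Ioi 0) :=
  integrableOn_exp_mul_Ioi (by linarith) 0

variable {E : Type*} [AddCommGroup E] [Module ℂ E] [UniformSpace E]

/-- For every `ℓ` dominated by `p`, the error of the `N`-th Riemann sum is at most `∫ p (s N t - f
t) dt`. This does not involve `ℓ` and tends to 0, so the sums converge uniformly on polars. -/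
theorem SeqComplete.exists_hasIntegralOn_Ioi [PolynormableSpace ℂ E] [IsUniformAddGroup E]
    (hE : SeqComplete E) {f : ℝ → E} (hf : Continuous f)
    (hbd : ∀ p : Seminorm ℂ E, Continuous p → ∃ K, ∀ t, 0 ≤ t → p (f t) ≤ K * Real.exp (-t)) :
    ∃ y, HasIntegralOn f (Ioi 0) y := by
  have hexp : IntegrableOn (fun t : ℝ => Real.exp (-t)) (Ioi 0) := by
    simpa using integrableOn_exp_neg_mul one_pos
  have hℓint : ∀ ℓ : E →L[ℂ] ℂ, IntegrableOn (fun t => ℓ (f t)) (Ioi 0) := by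
    intro ℓ
    obtain ⟨K, hK⟩ := hbd _ (continuous_functionalSeminorm ℓ)
    refine Integrable.mono' (hexp.const_mul K)
      (ℓ.continuous.comp hf).aestronglyMeasurable ?_
    filter_upwards [ae_restrict_mem measurableSet_Ioi] with t ht
    exact hK t (le_of_lt ht)
  let δ : ℕ → ℝ := fun N => 1 / ((N : ℝ) + 1)
  have hδ : ∀ N, 0 < δ N := fun N => by positivity
  have hδ0 : Tendsto δ atTop (𝓝 0) := tendsto_one_div_add_atTop_nhds_zero_nat
  have hδ1 : ∀ N, δ N ≤ 1 := fun N => by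
    simp only [δ]
    rw [div_le_one (by positivity)]
    linarith [(Nat.cast_nonneg N : (0 : ℝ) ≤ N)]
  -- There are `(N + 1)^2` cells of length `1/(N + 1)`: the mesh shrinks while the covered interval
  -- `[0, N + 1)` exhausts the half-line.
  let M : ℕ → ℕ := fun N => (N + 1) ^ 2
  let y : ℕ → E := fun N => ∑ k ∈ Finset.range (M N), (δ N : ℂ) • f (k * δ N)
  suffices h : ∃ z, ∀ ℓ : E →L[ℂ] ℂ, ℓ z = ∫ t in Ioi 0, ℓ (f t) by
    obtain ⟨z, hz⟩ := h
    exact ⟨z, fun ℓ => ⟨hℓint ℓ, (hz ℓ).symm⟩⟩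
  refine hE.exists_of_functional_approx _ y fun p hp => ?_
  let s : ℕ → ℝ → E := fun N t => if ⌊t / δ N⌋₊ < M N then f (⌊t / δ N⌋₊ * δ N) else 0
  let d : ℕ → ℝ → ℝ := fun N t => p (s N t - f t)
  obtain ⟨K, hK⟩ := hbd p hp
  have hK0 : 0 ≤ K := by
    have := (apply_nonneg p (f 0)).trans (hK 0 le_rfl)
    simpa using this
  have hfl : ∀ N t, 0 < t → ⌊t / δ N⌋₊ * δ N ≤ t ∧ t - δ N ≤ ⌊t / δ N⌋₊ * δ N := by
    intro N t ht
    have := (floor_div_eq_iff (hδ N) ht.le ⌊t / δ N⌋₊).1 rfl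
    refine ⟨this.1, ?_⟩
    have := this.2
    linarith
  have hdb : ∀ N t, 0 < t → d N t ≤ K * (Real.exp 1 + 1) * Real.exp (-t) := by
    intro N t ht
    -- The sample point precedes `t` by at most `δ N ≤ 1`, which costs the factor `e`.
    have h1 : p (s N t) ≤ K * Real.exp 1 * Real.exp (-t) := by
      simp only [s]
      split_ifs
      · refine (hK _ (by have := hδ N; positivity)).trans ?_
        rw [mul_assoc, ← Real.exp_add]
        gcongr
        have := (hfl N t ht).2
        have := hδ1 N
        linarith
      · rw [map_zero]; positivity
    have h2 := hK t ht.le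
    calc d N t ≤ p (s N t) + p (f t) := map_sub_le_add p _ _
      _ ≤ _ := by linarith
  have hdm : ∀ N, Measurable (d N) := by
    intro N
    -- Measurability is checked for real functions only, one for each cell index, and then glued
    -- over the countable set of indices.
    have h1 : ∀ k : ℕ, Measurable fun t : ℝ =>
        p ((if k < M N then f (k * δ N) else 0) - f t) := fun k =>
      (hp.comp (continuous_const.sub hf)).measurable
    have h2 : Measurable fun q : ℕ × ℝ => p ((if q.1 < M N then f (q.1 * δ N) else 0) - f q.2) :=
      measurable_from_prod_countable_right h1
    exact h2.comp ((Nat.measurable_floor.comp (measurable_id.div_const _)).prodMk measurable_id)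
  have hdi : ∀ N, IntegrableOn (d N) (Ioi 0) := by
    intro N
    refine Integrable.mono' (hexp.const_mul (K * (Real.exp 1 + 1))) (hdm N).aestronglyMeasurable ?_
    filter_upwards [ae_restrict_mem measurableSet_Ioi] with t ht
    rw [Real.norm_of_nonneg (apply_nonneg p _)]
    exact hdb N t ht
  refine ⟨fun N => ∫ t in Ioi 0, d N t, ?_, fun N ℓ hℓ => ?_⟩
  · suffices h : Tendsto (fun N => ∫ t in Ioi 0, d N t) atTop (𝓝 (∫ t in Ioi (0 : ℝ), (0 : ℝ))) by
      simpa using h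
    refine tendsto_integral_of_dominated_convergence
      (fun t => K * (Real.exp 1 + 1) * Real.exp (-t))
      (fun N => (hdm N).aestronglyMeasurable) (hexp.const_mul _) (fun N => ?_) ?_
    · filter_upwards [ae_restrict_mem measurableSet_Ioi] with t ht
      rw [Real.norm_of_nonneg (apply_nonneg p _)]
      exact hdb N t ht
    · filter_upwards [ae_restrict_mem measurableSet_Ioi] with t ht
      have hlim : Tendsto (fun N => (⌊t / δ N⌋₊ : ℝ) * δ N) atTop (𝓝 t) := by
        refine tendsto_of_tendsto_of_tendsto_of_le_of_le ?_ tendsto_const_nhds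
          (fun N => (hfl N t ht).2) (fun N => (hfl N t ht).1)
        simpa using tendsto_const_nhds.sub hδ0
      have h1 : Tendsto (fun N => p (f (⌊t / δ N⌋₊ * δ N) - f t)) atTop (𝓝 0) := by
        have h2 : Tendsto (fun r => p (f r - f t)) (𝓝 t) (𝓝 0) := by
          have hc : Continuous fun r => p (f r - f t) := hp.comp (hf.sub continuous_const)
          simpa using hc.tendsto t
        exact h2.comp hlim
      refine h1.congr' ?_
      filter_upwards [eventually_gt_atTop ⌈t⌉₊] with N hN
      have : ⌊t / δ N⌋₊ < M N := by
        rw [Nat.floor_lt (div_nonneg (le_of_lt ht) (hδ N).le), div_lt_iff₀ (hδ N)]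
        have h3 : t ≤ N := (Nat.le_ceil t).trans (by exact_mod_cast hN.le)
        simp only [M, δ]
        push_cast
        field_simp
        linarith
      simp only [d, s, if_pos this]
  · have hst := step_integral (hδ N) (M N) (fun k => ℓ (f (k * δ N)))
    have hy : ℓ (y N) = ∫ t in Ioi 0, ℓ (s N t) := by
      simp only [y, map_sum, map_smul, smul_eq_mul, s]
      rw [← hst.2]
      congr 1
      ext t
      split_ifs <;> simp
    have hsi : IntegrableOn (fun t => ℓ (s N t)) (Ioi 0) := by
      refine hst.1.congr_fun (fun t _ => ?_) measurableSet_Ioi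
      simp only [s]
      split_ifs <;> simp
    rw [hy, ← integral_sub hsi (hℓint ℓ)]
    refine norm_integral_le_of_norm_le (hdi N) (Eventually.of_forall fun t => ?_)
    rw [← map_sub]
    exact hℓ _

end ImproperIntegral

/-! ### The fractional integration kernel as a measure. -/

section WeylMeasure

/-- The measure `κ` with `W_+^{-(⌈α⌉ - α)} f (t) = ∫ f (t + u) dκ(u)`. -/
def weylMeasure (α : ℝ) : Measure ℝ :=
  open scoped Classical in
  if (⌈α⌉₊ : ℝ) = α then Measure.dirac 0
  else (volume.restrict (Ioi 0)).withDensity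
    fun u => ENNReal.ofReal (u ^ ((⌈α⌉₊ : ℝ) - α - 1) / Real.Gamma (⌈α⌉₊ - α))

/-- The fractional integral `∫ f (t + u) dκ(u)`. -/
def fracInt (α : ℝ) (f : ℝ → ℂ) (t : ℝ) : ℂ := ∫ u, f (t + u) ∂weylMeasure α

theorem ceil_sub_pos {α : ℝ} (h : ¬(⌈α⌉₊ : ℝ) = α) : 0 < (⌈α⌉₊ : ℝ) - α :=
  sub_pos.2 (lt_of_le_of_ne (Nat.le_ceil α) (Ne.symm h))

theorem weylMeasure_of_eq {α : ℝ} (h : (⌈α⌉₊ : ℝ) = α) : weylMeasure α = Measure.dirac 0 :=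
  if_pos h

theorem weylMeasure_of_ne {α : ℝ} (h : ¬(⌈α⌉₊ : ℝ) = α) :
    weylMeasure α = (volume.restrict (Ioi 0)).withDensity
      fun u => ENNReal.ofReal (u ^ ((⌈α⌉₊ : ℝ) - α - 1) / Real.Gamma (⌈α⌉₊ - α)) :=
  if_neg h

theorem measurable_weylDensity (α : ℝ) : Measurable
    fun u : ℝ => u ^ ((⌈α⌉₊ : ℝ) - α - 1) / Real.Gamma (⌈α⌉₊ - α) := by
  fun_prop

theorem weylDensity_nonneg {α : ℝ} (h : ¬(⌈α⌉₊ : ℝ) = α) {u : ℝ} (hu : u ∈ Ioi (0 : ℝ)) :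
    0 ≤ u ^ ((⌈α⌉₊ : ℝ) - α - 1) / Real.Gamma (⌈α⌉₊ - α) :=
  div_nonneg (Real.rpow_nonneg (le_of_lt hu) _) (Real.Gamma_pos_of_pos (ceil_sub_pos h)).le

theorem ae_weylMeasure_nonneg (α : ℝ) : ∀ᵐ u ∂weylMeasure α, 0 ≤ u := by
  by_cases h : (⌈α⌉₊ : ℝ) = α
  · rw [weylMeasure_of_eq h, ae_dirac_iff measurableSet_Ici]
  · rw [weylMeasure_of_ne h]
    refine (withDensity_absolutelyContinuous _ _).ae_le ?_
    filter_upwards [ae_restrict_mem measurableSet_Ioi] with u hu using le_of_lt hu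

theorem integrable_exp_weylMeasure (α : ℝ) {ω : ℝ} (hω : 0 < ω) :
    Integrable (fun u => Real.exp (-ω * u)) (weylMeasure α) := by
  by_cases h : (⌈α⌉₊ : ℝ) = α
  · rw [weylMeasure_of_eq h]
    exact integrable_dirac (by simp)
  · rw [weylMeasure_of_ne h, integrable_withDensity_iff_integrable_smul₀'
      (measurable_weylDensity α).ennreal_ofReal.aemeasurable (by simp)]
    have h1 := (integrableOn_rpow_mul_exp_neg_mul_rpow (s := (⌈α⌉₊ : ℝ) - α - 1) (p := 1)
      (by linarith [ceil_sub_pos h]) one_pos hω).const_mul (Real.Gamma (⌈α⌉₊ - α))⁻¹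
    refine IntegrableOn.congr_fun h1 (fun u hu => ?_) measurableSet_Ioi
    simp only [Real.rpow_one, smul_eq_mul]
    rw [ENNReal.toReal_ofReal (weylDensity_nonneg h hu)]
    ring

theorem fracInt_of_eq {α : ℝ} (h : (⌈α⌉₊ : ℝ) = α) (f : ℝ → ℂ) (t : ℝ) : fracInt α f t = f t := by
  rw [fracInt, weylMeasure_of_eq h, integral_dirac, add_zero]

theorem fracInt_of_ne {α : ℝ} (h : ¬(⌈α⌉₊ : ℝ) = α) (f : ℝ → ℂ) (t : ℝ) :
    fracInt α f t = ∫ u in Ioi (0 : ℝ),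
      ((u ^ ((⌈α⌉₊ : ℝ) - α - 1) / Real.Gamma (⌈α⌉₊ - α) : ℝ) : ℂ) * f (t + u) := by
  rw [fracInt, weylMeasure_of_ne h, integral_withDensity_eq_integral_toReal_smul₀
    (measurable_weylDensity α).ennreal_ofReal.aemeasurable (by simp)]
  refine setIntegral_congr_fun measurableSet_Ioi fun u hu => ?_
  rw [ENNReal.toReal_ofReal (weylDensity_nonneg h hu), Complex.real_smul]

/-- The total mass of `e^{-ω u} dκ(u)`. -/
def weylMass (α ω : ℝ) : ℝ := ∫ u, Real.exp (-ω * u) ∂weylMeasure α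

theorem weylMass_nonneg (α ω : ℝ) : 0 ≤ weylMass α ω :=
  integral_nonneg fun _ => (Real.exp_pos _).le

variable {α ω : ℝ} {f g : ℝ → ℂ} {A : ℝ}

theorem ae_norm_shift_le (hfb : ∀ s, 0 ≤ s → ‖f s‖ ≤ A * Real.exp (-ω * s)) {t : ℝ}
    (ht : 0 ≤ t) : ∀ᵐ u ∂weylMeasure α, ‖f (t + u)‖ ≤ A * Real.exp (-ω * t) * Real.exp (-ω * u) := by
  filter_upwards [ae_weylMeasure_nonneg α] with u hu
  rw [mul_assoc, ← Real.exp_add, ← mul_add]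
  exact hfb _ (add_nonneg ht hu)

theorem integrable_fracInt (hω : 0 < ω) (hf : Continuous f)
    (hfb : ∀ s, 0 ≤ s → ‖f s‖ ≤ A * Real.exp (-ω * s)) {t : ℝ} (ht : 0 ≤ t) :
    Integrable (fun u => f (t + u)) (weylMeasure α) :=
  Integrable.mono' ((integrable_exp_weylMeasure α hω).const_mul _)
    (by fun_prop : Continuous fun u => f (t + u)).aestronglyMeasurable (ae_norm_shift_le hfb ht)

/-- Since `κ` lives on `[0, ∞)`, the factor `e^{-ωt}` comes out of the integral, and the remaining
constant is the Laplace transform of `κ` at `ω`. Only values of `f` on `[0, ∞)` enter. -/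
theorem norm_fracInt_le (hω : 0 < ω)
    (hfb : ∀ s, 0 ≤ s → ‖f s‖ ≤ A * Real.exp (-ω * s)) {t : ℝ} (ht : 0 ≤ t) :
    ‖fracInt α f t‖ ≤ A * weylMass α ω * Real.exp (-ω * t) := by
  refine (norm_integral_le_of_norm_le ((integrable_exp_weylMeasure α hω).const_mul _)
    (ae_norm_shift_le hfb ht)).trans ?_
  rw [integral_const_mul, weylMass]
  apply le_of_eq
  ring

theorem continuousOn_fracInt (hω : 0 < ω) (hf : Continuous f)
    (hfb : ∀ s, 0 ≤ s → ‖f s‖ ≤ A * Real.exp (-ω * s)) :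
    ContinuousOn (fracInt α f) (Ici 0) := by
  have hA : 0 ≤ A := by simpa using (norm_nonneg _).trans (hfb 0 le_rfl)
  refine continuousOn_of_dominated (bound := fun u => A * Real.exp (-ω * u))
    (fun t _ => (by fun_prop : Continuous fun u => f (t + u)).aestronglyMeasurable) (fun t ht => ?_)
    ((integrable_exp_weylMeasure α hω).const_mul _) (Eventually.of_forall fun u => by fun_prop)
  filter_upwards [ae_norm_shift_le hfb ht] with u hu
  refine hu.trans ?_
  gcongr
  refine mul_le_of_le_one_right hA (Real.exp_le_one_iff.2 ?_)
  have : 0 ≤ ω * t := mul_nonneg hω.le ht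
  linarith

theorem fracInt_add {B : ℝ} (hω : 0 < ω) (hf : Continuous f)
    (hfb : ∀ s, 0 ≤ s → ‖f s‖ ≤ A * Real.exp (-ω * s)) (hg : Continuous g)
    (hgb : ∀ s, 0 ≤ s → ‖g s‖ ≤ B * Real.exp (-ω * s)) {t : ℝ} (ht : 0 ≤ t) :
    fracInt α (f + g) t = fracInt α f t + fracInt α g t :=
  integral_add (integrable_fracInt hω hf hfb ht) (integrable_fracInt hω hg hgb ht)

theorem fracInt_smul (c : ℂ) (t : ℝ) : fracInt α (c • f) t = c * fracInt α f t :=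
  integral_const_mul _ _

end WeylMeasure

/-! ### Derivatives and sup norms of test functions. -/

section TestFunctions

@[simp] theorem derivTest_apply (φ : TestFn) (t : ℝ) : derivTest φ t = deriv φ t := rfl

@[simp] theorem expMul_apply (ω : ℝ) (φ : TestFn) (t : ℝ) :
    expMul ω φ t = (Real.exp (ω * t) : ℂ) * φ t := rfl

@[simp] theorem conv₀_apply (φ ψ : TestFn) (t : ℝ) : conv₀ φ ψ t = conv₀Fun φ ψ t := rfl

theorem differentiable_testFn (φ : TestFn) : Differentiable ℝ φ :=
  φ.contDiff.differentiable (by simp)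

theorem hasDerivAt_testFn (φ : TestFn) (t : ℝ) : HasDerivAt φ (derivTest φ t) t :=
  (differentiable_testFn φ t).hasDerivAt

theorem iterate_derivTest_apply (n : ℕ) (φ : TestFn) :
    ⇑(derivTest^[n] φ) = iteratedDeriv n φ := by
  induction n generalizing φ with
  | zero => simp
  | succ n ih =>
    rw [Function.iterate_succ_apply, ih, iteratedDeriv_succ']
    rfl

/-- The derivative as a linear map. -/
def derivTestₗ : TestFn →ₗ[ℂ] TestFn where
  toFun := derivTest
  map_add' φ ψ := by
    ext t
    exact deriv_add (differentiable_testFn φ t) (differentiable_testFn ψ t)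
  map_smul' c φ := by
    ext t
    exact deriv_const_smul c (differentiable_testFn φ t)

theorem derivTest_add (φ ψ : TestFn) : derivTest (φ + ψ) = derivTest φ + derivTest ψ :=
  map_add derivTestₗ φ ψ

theorem derivTest_sub (φ ψ : TestFn) : derivTest (φ - ψ) = derivTest φ - derivTest ψ :=
  map_sub derivTestₗ φ ψ

theorem derivTest_smul (c : ℂ) (φ : TestFn) : derivTest (c • φ) = c • derivTest φ :=
  map_smul derivTestₗ c φ

theorem iterate_derivTest_add (n : ℕ) (φ ψ : TestFn) :
    derivTest^[n] (φ + ψ) = derivTest^[n] φ + derivTest^[n] ψ := by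
  induction n generalizing φ ψ with
  | zero => rfl
  | succ n ih => simp only [Function.iterate_succ_apply, derivTest_add, ih]

theorem iterate_derivTest_smul (n : ℕ) (c : ℂ) (φ : TestFn) :
    derivTest^[n] (c • φ) = c • derivTest^[n] φ := by
  induction n generalizing φ with
  | zero => rfl
  | succ n ih => simp only [Function.iterate_succ_apply, derivTest_smul, ih]

theorem iterate_derivTest_sub (n : ℕ) (φ ψ : TestFn) :
    derivTest^[n] (φ - ψ) = derivTest^[n] φ - derivTest^[n] ψ := by
  induction n generalizing φ ψ with
  | zero => rfl
  | succ n ih => simp only [Function.iterate_succ_apply, derivTest_sub, ih]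

/-- The supremum norm of a test function. -/
def supNorm (φ : TestFn) : ℝ := ‖TestFunction.toBoundedContinuousFunctionCLM ℂ φ‖

theorem norm_apply_le_supNorm (φ : TestFn) (t : ℝ) : ‖φ t‖ ≤ supNorm φ :=
  (TestFunction.toBoundedContinuousFunctionCLM ℂ φ).norm_coe_le_norm t

theorem supNorm_nonneg (φ : TestFn) : 0 ≤ supNorm φ := norm_nonneg _

theorem supNorm_le {φ : TestFn} {A : ℝ} (h : ∀ t, ‖φ t‖ ≤ A) : supNorm φ ≤ A :=
  (BoundedContinuousFunction.norm_le ((norm_nonneg _).trans (h 0))).2 h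

theorem supNorm_add_le (φ ψ : TestFn) : supNorm (φ + ψ) ≤ supNorm φ + supNorm ψ := by
  simpa [supNorm, map_add] using norm_add_le _ _

theorem supNorm_smul (c : ℂ) (φ : TestFn) : supNorm (c • φ) = ‖c‖ * supNorm φ := by
  simp [supNorm, map_smul, norm_smul]

theorem norm_testFn_le_exp (ω : ℝ) (φ : TestFn) (t : ℝ) :
    ‖φ t‖ ≤ supNorm (expMul ω φ) * Real.exp (-ω * t) := by
  have h := norm_apply_le_supNorm (expMul ω φ) t
  rw [expMul_apply, norm_mul, Complex.norm_real, Real.norm_of_nonneg (Real.exp_pos _).le] at h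
  calc ‖φ t‖ = Real.exp (ω * t) * ‖φ t‖ * Real.exp (-ω * t) := by
        rw [mul_right_comm, ← Real.exp_add]; simp
    _ ≤ _ := by gcongr

end TestFunctions

/-! ### The Weyl derivative as a fractional integral of an ordinary derivative. -/

section WeylDeriv

theorem setIntegral_Ioi_comp_add_left (g : ℝ → ℂ) (r : ℝ) :
    ∫ u in Ioi (0 : ℝ), g (r + u) = ∫ s in Ioi r, g s := by
  rw [← integral_indicator measurableSet_Ioi, ← integral_indicator measurableSet_Ioi,
    ← integral_add_left_eq_self ((Ioi r).indicator g) r]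
  congr 1
  ext u
  by_cases hu : 0 < u
  · rw [indicator_of_mem (mem_Ioi.2 hu), indicator_of_mem (mem_Ioi.2 (lt_add_of_pos_right r hu))]
  · rw [indicator_of_notMem (by simpa using hu), indicator_of_notMem (by simpa using hu)]

variable {α : ℝ}

theorem hasDerivAt_fracInt (φ : TestFn) (t : ℝ) :
    HasDerivAt (fracInt α φ) (fracInt α (derivTest φ) t) t := by
  have hb := norm_testFn_le_exp 1 (derivTest φ)
  refine (hasDerivAt_integral_of_dominated_loc_of_deriv_le (Metric.ball_mem_nhds t one_pos)
    (bound := fun u => supNorm (expMul 1 (derivTest φ)) * Real.exp (-1 * (t - 1)) *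
      Real.exp (-1 * u))
    (F' := fun r u => derivTest φ (r + u)) (Eventually.of_forall fun r => ?_) ?_ ?_ ?_ ?_ ?_).2
  · exact (by fun_prop : Continuous fun u => φ (r + u)).aestronglyMeasurable
  · refine Integrable.mono' ((integrable_exp_weylMeasure α one_pos).const_mul
      (supNorm (expMul 1 φ) * Real.exp (-1 * t)))
      (by fun_prop : Continuous fun u => φ (t + u)).aestronglyMeasurable
      (Eventually.of_forall fun u => ?_)
    rw [mul_assoc, ← Real.exp_add, ← mul_add]
    exact norm_testFn_le_exp 1 φ _
  · exact (by fun_prop : Continuous fun u => derivTest φ (t + u)).aestronglyMeasurable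
  · refine Eventually.of_forall fun u r hr => (hb _).trans ?_
    rw [mul_assoc, ← Real.exp_add, ← mul_add]
    have := supNorm_nonneg (expMul 1 (derivTest φ))
    gcongr ?_ * Real.exp ?_
    rw [Metric.mem_ball, Real.dist_eq, abs_lt] at hr
    linarith
  · exact (integrable_exp_weylMeasure α one_pos).const_mul _
  · refine Eventually.of_forall fun u r _ => ?_
    simpa using (hasDerivAt_testFn φ (r + u)).comp_add_const r u

theorem iteratedDeriv_fracInt (n : ℕ) (φ : TestFn) :
    iteratedDeriv n (fracInt α φ) = fracInt α (derivTest^[n] φ) := by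
  induction n generalizing φ with
  | zero => simp
  | succ n ih =>
    rw [iteratedDeriv_succ', Function.iterate_succ_apply, ← ih]
    congr 1
    ext t
    exact (hasDerivAt_fracInt φ t).deriv

/-- The derivatives are moved inside the integral onto `φ`. This treats integer and non-integer `α`
uniformly and leaves only an integrable kernel. -/
theorem weylDeriv_eq (φ : TestFn) (t : ℝ) :
    weylDeriv α φ t = (-1) ^ ⌈α⌉₊ * fracInt α (derivTest^[⌈α⌉₊] φ) t := by
  rw [weylDeriv]
  split_ifs with h
  · rw [fracInt_of_eq h, iterate_derivTest_apply]
  · rw [← iteratedDeriv_fracInt]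
    have hf : fracInt α φ = (Real.Gamma (⌈α⌉₊ - α) : ℂ)⁻¹ • fun r : ℝ =>
        ∫ s in Ioi r, (((s - r) ^ ((⌈α⌉₊ : ℝ) - α - 1) : ℝ) : ℂ) * φ s := by
      ext r
      rw [fracInt_of_ne h, Pi.smul_apply, smul_eq_mul, ← integral_const_mul]
      rw [← setIntegral_Ioi_comp_add_left _ r]
      refine setIntegral_congr_fun measurableSet_Ioi fun u _ => ?_
      simp only [add_sub_cancel_left]
      push_cast
      ring
    rw [hf, iteratedDeriv_const_smul_field]
    simp only [smul_eq_mul]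
    ring

end WeylDeriv

/-! ### Pairing of `Θ_α` with Weyl derivatives. -/

section ThetaIntegral

theorem integral_beta {a b s : ℝ} (ha : 0 ≤ a) (hb : 0 < b) (hs : 0 < s) :
    ∫ t in (0 : ℝ)..s, ((t ^ a / Real.Gamma (a + 1) : ℝ) : ℂ) *
      (((s - t) ^ (b - 1) / Real.Gamma b : ℝ) : ℂ) =
      ((s ^ (a + b) / Real.Gamma (a + b + 1) : ℝ) : ℂ) := by
  have h1 := Complex.betaIntegral_scaled ((a : ℂ) + 1) b hs
  have h2 : ∫ t in (0 : ℝ)..s, ((t ^ a / Real.Gamma (a + 1) : ℝ) : ℂ) *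
      (((s - t) ^ (b - 1) / Real.Gamma b : ℝ) : ℂ) =
      ((Real.Gamma (a + 1) : ℂ))⁻¹ * ((Real.Gamma b : ℂ))⁻¹ *
        ∫ t in (0 : ℝ)..s, (t : ℂ) ^ ((a : ℂ) + 1 - 1) * ((s : ℂ) - t) ^ ((b : ℂ) - 1) := by
    rw [← intervalIntegral.integral_const_mul]
    refine intervalIntegral.integral_congr fun t ht => ?_
    rw [uIcc_of_le hs.le] at ht
    have e1 : ((t ^ a : ℝ) : ℂ) = (t : ℂ) ^ ((a : ℂ) + 1 - 1) := by
      rw [Complex.ofReal_cpow ht.1, add_sub_cancel_right]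
    have e2 : (((s - t) ^ (b - 1) : ℝ) : ℂ) = ((s : ℂ) - t) ^ ((b : ℂ) - 1) := by
      rw [Complex.ofReal_cpow (sub_nonneg.2 ht.2)]
      push_cast
      rfl
    rw [← e1, ← e2]
    push_cast
    ring
  have h3 := Complex.Gamma_mul_Gamma_eq_betaIntegral (s := (a : ℂ) + 1) (t := b)
    (by simp; linarith) (by simpa using hb)
  have e3 : (s : ℂ) ^ ((a : ℂ) + 1 + b - 1) = ((s ^ (a + b) : ℝ) : ℂ) := by
    rw [Complex.ofReal_cpow hs.le]
    push_cast
    congr 1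
    ring
  have g1 : Complex.Gamma ((a : ℂ) + 1) = (Real.Gamma (a + 1) : ℂ) := by
    rw [← Complex.Gamma_ofReal]; push_cast; rfl
  have g2 : Complex.Gamma (b : ℂ) = (Real.Gamma b : ℂ) := Complex.Gamma_ofReal b
  have g3 : Complex.Gamma ((a : ℂ) + 1 + b) = (Real.Gamma (a + b + 1) : ℂ) := by
    rw [← Complex.Gamma_ofReal]; push_cast; congr 1; ring
  rw [g1, g2, g3] at h3
  have n1 : (Real.Gamma (a + 1) : ℂ) ≠ 0 := by
    exact_mod_cast (Real.Gamma_pos_of_pos (by linarith)).ne'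
  have n2 : (Real.Gamma b : ℂ) ≠ 0 := by exact_mod_cast (Real.Gamma_pos_of_pos hb).ne'
  have n3 : (Real.Gamma (a + b + 1) : ℂ) ≠ 0 := by
    exact_mod_cast (Real.Gamma_pos_of_pos (by linarith)).ne'
  rw [h2, h1, e3, Complex.ofReal_div]
  field_simp
  linear_combination (-((s ^ (a + b) : ℝ) : ℂ)) * h3

/-- By Fubini the fractional integral can be moved from `f` to `Θ_α`, and convolving `Θ_α` with the
kernel of order `n - α` gives `Θ_n(s) = s^n / n!` by `integral_beta`. -/
theorem integral_Theta_mul_fracInt {α : ℝ} (hα : 0 ≤ α) (f : TestFn) :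
    ∫ t in Ioi (0 : ℝ), Theta α t * fracInt α f t =
      ∫ s in Ioi (0 : ℝ), ((s ^ ⌈α⌉₊ / (⌈α⌉₊).factorial : ℝ) : ℂ) * f s := by
  by_cases h : (⌈α⌉₊ : ℝ) = α
  · simp only [fracInt_of_eq h, Theta]
    have e : ∀ t : ℝ, t ^ α = t ^ ⌈α⌉₊ := fun t => by rw [← Real.rpow_natCast, h]
    have e2 : Real.Gamma (α + 1) = (⌈α⌉₊).factorial := by rw [← Real.Gamma_nat_eq_factorial, h]
    simp only [e, e2]
  set β : ℝ := (⌈α⌉₊ : ℝ) - α with hβ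
  have hβ0 : 0 < β := ceil_sub_pos h
  obtain ⟨b, hb0, hb⟩ : ∃ b : ℝ, 0 ≤ b ∧ ∀ s, b < s → f s = 0 := by
    obtain ⟨R, hR⟩ := f.hasCompactSupport.isCompact.isBounded.subset_closedBall (0 : ℝ)
    refine ⟨|R|, abs_nonneg R, fun s hs => image_eq_zero_of_notMem_tsupport fun hmem => ?_⟩
    have := hR hmem
    rw [Metric.mem_closedBall, Real.dist_eq, sub_zero] at this
    linarith [le_abs_self s, le_abs_self R]
  -- Both kernels are cut off at `b`, beyond which `f` vanishes: the integrals do not change, and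
  -- the factors become integrable as Fubini needs.
  let a0 : ℝ → ℂ := (Ioc 0 b).indicator fun t => ((t ^ α / Real.Gamma (α + 1) : ℝ) : ℂ)
  let k0 : ℝ → ℂ := (Ioc 0 b).indicator fun u => ((u ^ (β - 1) / Real.Gamma β : ℝ) : ℂ)
  have ha0 : Integrable a0 := by
    rw [integrable_indicator_iff measurableSet_Ioc]
    refine Integrable.ofReal (Integrable.div_const ?_ _)
    rw [← IntegrableOn, ← intervalIntegrable_iff_integrableOn_Ioc_of_le hb0]
    exact intervalIntegral.intervalIntegrable_rpow' (by linarith)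
  have hk0 : Integrable k0 := by
    rw [integrable_indicator_iff measurableSet_Ioc]
    refine Integrable.ofReal (Integrable.div_const ?_ _)
    rw [← IntegrableOn, ← intervalIntegrable_iff_integrableOn_Ioc_of_le hb0]
    exact intervalIntegral.intervalIntegrable_rpow' (by linarith)
  have hF : Integrable (Function.uncurry fun s t : ℝ => f s * (a0 t * k0 (s - t)))
      (volume.prod volume) := by
    have h1 := Integrable.convolution_integrand (μ := volume) (ν := volume)
      (ContinuousLinearMap.mul ℝ ℂ) ha0 hk0
    refine h1.bdd_mul (c := supNorm f) (f := fun p : ℝ × ℝ => f p.1)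
      (by fun_prop : Continuous fun p : ℝ × ℝ => f p.1).aestronglyMeasurable
      (Eventually.of_forall fun p => norm_apply_le_supNorm f p.1)
  have hswap := integral_integral_swap hF
  have hL : ∀ t, ∫ s, f s * (a0 t * k0 (s - t)) =
      (Ioi (0 : ℝ)).indicator (fun t => Theta α t * fracInt α f t) t := by
    intro t
    by_cases ht : 0 < t
    swap
    · rw [indicator_of_notMem (by simpa using ht)]
      have : a0 t = 0 := indicator_of_notMem (fun h => ht h.1) _
      simp [this]
    rw [indicator_of_mem (mem_Ioi.2 ht), fracInt_of_ne h, ← integral_add_left_eq_self _ t,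
      ← integral_const_mul, ← integral_indicator measurableSet_Ioi]
    congr 1
    ext u
    rw [add_sub_cancel_left]
    by_cases hu : 0 < u
    swap
    · have : k0 u = 0 := indicator_of_notMem (fun h => hu h.1) _
      rw [indicator_of_notMem (by simpa using hu), this]
      simp
    rw [indicator_of_mem (mem_Ioi.2 hu)]
    by_cases hb' : b < t + u
    · rw [hb _ hb']; simp
    have e1 : a0 t = Theta α t := indicator_of_mem (show t ∈ Ioc 0 b from ⟨ht, by linarith⟩) _
    have e2 : k0 u = ((u ^ (β - 1) / Real.Gamma β : ℝ) : ℂ) :=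
      indicator_of_mem (show u ∈ Ioc 0 b from ⟨hu, by linarith⟩) _
    rw [e1, e2]
    ring
  have hR : ∀ s, ∫ t, f s * (a0 t * k0 (s - t)) =
      (Ioi (0 : ℝ)).indicator
        (fun s => ((s ^ ⌈α⌉₊ / (⌈α⌉₊).factorial : ℝ) : ℂ) * f s) s := by
    intro s
    by_cases hs : 0 < s
    swap
    · rw [indicator_of_notMem (by simpa using hs)]
      have : ∀ t, a0 t * k0 (s - t) = 0 := by
        intro t
        by_cases ht : 0 < t
        · have : k0 (s - t) = 0 := indicator_of_notMem (fun h => by have := h.1; linarith) _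
          rw [this, mul_zero]
        · have : a0 t = 0 := indicator_of_notMem (fun h => ht h.1) _
          rw [this, zero_mul]
      simp [this]
    rw [indicator_of_mem (mem_Ioi.2 hs)]
    by_cases hb' : b < s
    · rw [hb _ hb']; simp
    have e := integral_beta hα hβ0 hs
    have e1 : α + β = (⌈α⌉₊ : ℝ) := by rw [hβ]; ring
    rw [e1, Real.Gamma_nat_eq_factorial, Real.rpow_natCast] at e
    rw [integral_const_mul, ← e, mul_comm, intervalIntegral.integral_of_le hs.le,
      ← integral_Ioc_eq_integral_Ioo.symm, ← integral_indicator measurableSet_Ioo]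
    congr 2
    ext t
    by_cases ht : t ∈ Ioo 0 s
    · have e1 : a0 t = ((t ^ α / Real.Gamma (α + 1) : ℝ) : ℂ) :=
        indicator_of_mem (show t ∈ Ioc 0 b from ⟨ht.1, by linarith [ht.2]⟩) _
      have e2 : k0 (s - t) = (((s - t) ^ (β - 1) / Real.Gamma β : ℝ) : ℂ) :=
        indicator_of_mem (show s - t ∈ Ioc 0 b from ⟨by linarith [ht.2], by linarith [ht.1]⟩) _
      rw [indicator_of_mem ht, e1, e2]
    · rw [indicator_of_notMem ht]
      by_cases ht1 : 0 < t
      · have : k0 (s - t) = 0 := indicator_of_notMem (fun h => ht ⟨ht1, by linarith [h.1]⟩) _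
        rw [this, mul_zero]
      · have : a0 t = 0 := indicator_of_notMem (fun h => ht1 h.1) _
        rw [this, zero_mul]
  simp only [hL, hR] at hswap
  rw [integral_indicator measurableSet_Ioi, integral_indicator measurableSet_Ioi] at hswap
  exact hswap.symm

theorem integral_pow_mul_iterate_derivTest (n : ℕ) (φ : TestFn) :
    ∫ s in Ioi (0 : ℝ), ((s ^ n / n.factorial : ℝ) : ℂ) * derivTest^[n + 1] φ s =
      (-1) ^ (n + 1) * φ 0 := by
  have hint : ∀ (n : ℕ) (ψ : TestFn), Integrable (fun s : ℝ => ((s ^ n / n.factorial : ℝ) : ℂ) * ψ s) :=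
    fun n ψ => Continuous.integrable_of_hasCompactSupport (by fun_prop) ψ.hasCompactSupport.mul_left
  have htop : ∀ (n : ℕ) (ψ : TestFn),
      Tendsto (fun s : ℝ => ((s ^ n / n.factorial : ℝ) : ℂ) * ψ s) atTop (𝓝 0) := by
    intro n ψ
    have h1 : HasCompactSupport (fun s : ℝ => ((s ^ n / n.factorial : ℝ) : ℂ) * ψ s) :=
      ψ.hasCompactSupport.mul_left
    exact h1.is_zero_at_infty.mono_left atTop_le_cocompact
  induction n generalizing φ with
  | zero =>
    have h1 := integral_Ioi_of_hasDerivAt_of_tendsto' (a := 0) (fun s _ => hasDerivAt_testFn φ s)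
      (integrable_testFn (derivTest φ)).integrableOn (by simpa using htop 0 φ)
    simpa using h1
  | succ n ih =>
    have hu : ∀ s ∈ Ioi (0 : ℝ), HasDerivAt (fun s : ℝ => ((s ^ (n + 1) / (n + 1).factorial : ℝ) : ℂ))
        ((s ^ n / n.factorial : ℝ) : ℂ) s := by
      intro s _
      refine HasDerivAt.ofReal_comp ?_
      have := (hasDerivAt_pow (n + 1) s).div_const ((n + 1).factorial : ℝ)
      have e : ((n + 1 : ℕ) : ℝ) * s ^ (n + 1 - 1) / (n + 1).factorial = s ^ n / n.factorial := by
        rw [Nat.factorial_succ, add_tsub_cancel_right]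
        push_cast
        field_simp
      rwa [e] at this
    have hv : ∀ s ∈ Ioi (0 : ℝ), HasDerivAt (derivTest^[n + 1] φ) (derivTest^[n + 2] φ s) s := by
      intro s _
      rw [Function.iterate_succ_apply' derivTest (n + 1)]
      exact hasDerivAt_testFn _ s
    have h0 : Tendsto ((fun s : ℝ => ((s ^ (n + 1) / (n + 1).factorial : ℝ) : ℂ)) *
        (derivTest^[n + 1] φ : ℝ → ℂ)) (𝓝[>] 0) (𝓝 0) := by
      have hc : Continuous fun s : ℝ => ((s ^ (n + 1) / (n + 1).factorial : ℝ) : ℂ) *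
        derivTest^[n + 1] φ s := by fun_prop
      have := (hc.tendsto 0).mono_left (nhdsWithin_le_nhds (s := Ioi 0))
      rw [zero_pow (Nat.succ_ne_zero n), zero_div, Complex.ofReal_zero, zero_mul] at this
      exact this
    rw [integral_Ioi_mul_deriv_eq_deriv_mul hu hv (hint _ _).integrableOn (hint _ _).integrableOn
      h0 (htop _ _), ih]
    ring

/-- This is the source of the term `φ(0) C x` in the action of `A` on `G φ x`. The signs `(-1)^n`
and `(-1)^(n+1)` combine to `-1`. -/
theorem integral_Theta_mul_weylDeriv {α : ℝ} (hα : 0 ≤ α) (φ : TestFn) :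
    ∫ t in Ioi (0 : ℝ), Theta α t * weylDeriv α (derivTest φ) t = -φ 0 := by
  simp only [weylDeriv_eq]
  have : ∀ t, Theta α t * ((-1) ^ ⌈α⌉₊ * fracInt α (derivTest^[⌈α⌉₊] (derivTest φ)) t) =
      (-1) ^ ⌈α⌉₊ * (Theta α t * fracInt α (derivTest^[⌈α⌉₊] (derivTest φ)) t) := fun t => by ring
  simp only [this]
  rw [integral_const_mul, integral_Theta_mul_fracInt hα, ← Function.iterate_succ_apply,
    integral_pow_mul_iterate_derivTest, ← mul_assoc, ← pow_add]
  have : ⌈α⌉₊ + (⌈α⌉₊ + 1) = 2 * ⌈α⌉₊ + 1 := by ring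
  rw [this, pow_succ, pow_mul]
  simp

end ThetaIntegral

/-! ### Continuous weighted seminorms on the test functions. -/

section ContinuousTestFunctionMaps

/-- The derivative as a continuous linear map on test functions. -/
def derivTestCLM : TestFn →L[ℂ] TestFn := TestFunction.lineDerivCLM ℂ 1

theorem derivTestCLM_apply (φ : TestFn) : derivTestCLM φ = derivTest φ := by
  ext t
  rw [derivTestCLM, TestFunction.lineDerivCLM_apply_of_le (by simp),
    (differentiable_testFn φ t).lineDeriv_eq_fderiv]
  simp

theorem derivTestCLM_pow_apply (n : ℕ) (φ : TestFn) : (derivTestCLM ^ n) φ = derivTest^[n] φ := by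
  induction n generalizing φ with
  | zero => rfl
  | succ n ih =>
    rw [pow_succ, mul_apply_eq_comp, derivTestCLM_apply, ih,
      Function.iterate_succ_apply]

theorem contDiff_exp_ofReal (ω : ℝ) :
    ContDiff ℝ (⊤ : ℕ∞) fun t : ℝ => (Real.exp (ω * t) : ℂ) :=
  Complex.ofRealCLM.contDiff.comp (Real.contDiff_exp.comp (contDiff_const.mul contDiff_id))

/-- Multiplication by `e^{ω t}`, with values in the bounded continuous functions. -/
def expMulCLM (ω : ℝ) : TestFn →L[ℂ] BoundedContinuousFunction ℝ ℂ :=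
  TestFunction.limitCLM ℂ
    (fun φ => TestFunction.toBoundedContinuousFunctionCLM ℂ (expMul ω φ))
    (fun _ _ => (ContDiffMapSupportedIn.toBoundedContinuousFunctionCLM ℂ).comp
      (ContDiffMapSupportedIn.bilinLeftCLM (ContinuousLinearMap.mul ℂ ℂ) (contDiff_exp_ofReal ω)))
    (fun K hK f => by
      ext t
      simp [mul_comm])

theorem norm_expMulCLM (ω : ℝ) (φ : TestFn) : ‖expMulCLM ω φ‖ = supNorm (expMul ω φ) := rfl

/-- The continuous seminorm `φ ↦ sup_t |e^{ω t} φ^{(n)}(t)|`. -/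
def expSeminorm (ω : ℝ) (n : ℕ) : Seminorm ℂ TestFn :=
  (normSeminorm ℂ (BoundedContinuousFunction ℝ ℂ)).comp
    ((expMulCLM ω).comp (derivTestCLM ^ n)).toLinearMap

theorem expSeminorm_apply (ω : ℝ) (n : ℕ) (φ : TestFn) :
    expSeminorm ω n φ = supNorm (expMul ω (derivTest^[n] φ)) := by
  rw [← norm_expMulCLM, ← derivTestCLM_pow_apply]
  rfl

theorem continuous_expSeminorm (ω : ℝ) (n : ℕ) : Continuous (expSeminorm ω n) :=
  ((expMulCLM ω).comp (derivTestCLM ^ n)).continuous.norm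

end ContinuousTestFunctionMaps

/-! ### Seminorm criteria for continuity, including into `L(E)`. -/

section ContinuityCriteria

variable {E : Type*} [AddCommGroup E] [Module ℂ E] [UniformSpace E] [IsUniformAddGroup E]
  [PolynormableSpace ℂ E]

theorem continuous_of_seminorm_le (T : E →ₗ[ℂ] E)
    (h : ∀ p : Seminorm ℂ E, Continuous p → ∃ q : Seminorm ℂ E, Continuous q ∧
      ∀ x, p (T x) ≤ q x) : Continuous T := by
  refine continuous_of_continuousAt_zero T ?_
  rw [ContinuousAt, map_zero, (PolynormableSpace.withSeminorms ℂ E).tendsto_nhds]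
  rintro ⟨p, hp⟩ ε hε
  obtain ⟨q, hq, hle⟩ := h p hp
  have h0 : ∀ᶠ x in 𝓝 0, q x < ε :=
    (hq.tendsto 0).eventually_lt_const (by simpa using hε)
  filter_upwards [h0] with x hx
  rw [sub_zero]
  exact (hle x).trans_lt hx

/-- A product bound suffices for the topology of bounded convergence because `q` is bounded on each
bounded set. -/
theorem continuous_operator_of_seminorm_le {F : Type*} [AddCommGroup F] [Module ℂ F]
    [TopologicalSpace F] [IsTopologicalAddGroup F] [ContinuousSMul ℂ E] (T : F →ₗ[ℂ] E →L[ℂ] E)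
    (h : ∀ p : Seminorm ℂ E, Continuous p → ∃ N : Seminorm ℂ F, Continuous N ∧
      ∃ q : Seminorm ℂ E, Continuous q ∧ ∀ φ x, p (T φ x) ≤ N φ * q x) : Continuous T := by
  refine continuous_of_continuousAt_zero T ?_
  have hb := ContinuousLinearMap.hasBasis_nhds_zero_of_basis (𝕜₁ := ℂ) (𝕜₂ := ℂ) (E := E) (F := E)
    (σ := RingHom.id ℂ) (PolynormableSpace.withSeminorms ℂ E).hasBasis_zero_ball
  rw [ContinuousAt, map_zero, hb.tendsto_right_iff]
  rintro ⟨B, s, ε⟩ ⟨hB, hε⟩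
  simp only at hB hε
  have key : ∀ i ∈ s, ∀ᶠ φ in 𝓝 (0 : F), ∀ x ∈ B, i.1 (T φ x) < ε := by
    rintro ⟨p, hp⟩ -
    obtain ⟨N, hN, q, hq, hle⟩ := h p hp
    obtain ⟨M, hM, hBM⟩ := bounded_on_of_isVonNBounded hB hq
    have h0 : ∀ᶠ φ in 𝓝 (0 : F), N φ * M < ε := by
      have : Tendsto (fun φ => N φ * M) (𝓝 0) (𝓝 (N 0 * M)) := (hN.tendsto 0).mul_const M
      exact this.eventually_lt_const (by simpa using hε)
    filter_upwards [h0] with φ hφ x hx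
    refine ((hle φ x).trans ?_).trans_lt hφ
    gcongr
    exact hBM x hx
  filter_upwards [(Finset.eventually_all s).2 key] with φ hφ x hx
  rw [Seminorm.mem_ball, sub_zero]
  exact Seminorm.finset_sup_apply_lt hε fun i hi => hφ i hi x hx

end ContinuityCriteria

/-! ### Operators obtained by integrating the semigroup against a fractional integral. -/

section WeylOperators

variable {E : Type*} [AddCommGroup E] [Module ℂ E] [UniformSpace E]

theorem integral_weight_mul_exp (c ω : ℝ) :
    IntegrableOn (fun t : ℝ => c * Real.exp (-(ω + 1) * t) * Real.exp (ω * t)) (Ioi 0) ∧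
    ∫ t in Ioi (0 : ℝ), c * Real.exp (-(ω + 1) * t) * Real.exp (ω * t) = c := by
  have h : ∀ t : ℝ, c * Real.exp (-(ω + 1) * t) * Real.exp (ω * t) = c * Real.exp (-t) := by
    intro t
    rw [mul_assoc, ← Real.exp_add]
    congr 2
    ring
  simp only [h]
  refine ⟨?_, ?_⟩
  · have := integrableOn_exp_neg_mul one_pos
    simp only [neg_mul, one_mul] at this
    exact this.const_mul c
  · rw [integral_const_mul, integral_exp_neg_Ioi_zero, mul_one]

variable {S : ℝ → E →L[ℂ] E} {α : ℝ}

/-- Decay of rate `ω + 1` against growth of rate `ω` leaves `∫ e^{-t} dt = 1`, so no further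
constant appears. -/
theorem seminorm_weylOp_le [PolynormableSpace ℂ E] {f : ℝ → ℂ} {p q : Seminorm ℂ E}
    (hp : Continuous p) {ω A : ℝ} (hω : 0 ≤ ω)
    (hS : ∀ t, 0 ≤ t → ∀ x, p (S t x) ≤ Real.exp (ω * t) * q x)
    (hf : ∀ s, 0 ≤ s → ‖f s‖ ≤ A * Real.exp (-(ω + 1) * s)) {x y : E}
    (hy : HasIntegralOn (fun t => fracInt α f t • S t x) (Ioi 0) y) :
    p y ≤ A * weylMass α (ω + 1) * q x := by
  obtain ⟨h1, h2⟩ := integral_weight_mul_exp (A * weylMass α (ω + 1) * q x) ω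
  refine (hy.seminorm_le measurableSet_Ioi hp h1 fun t ht => ?_).trans_eq h2
  have ht : 0 ≤ t := le_of_lt ht
  rw [map_smul_eq_mul]
  have h3 := norm_fracInt_le (α := α) (by linarith : 0 < ω + 1) hf ht
  calc ‖fracInt α f t‖ * p (S t x) ≤
      (A * weylMass α (ω + 1) * Real.exp (-(ω + 1) * t)) * (Real.exp (ω * t) * q x) :=
        mul_le_mul h3 (hS t ht x) (apply_nonneg p _) ((norm_nonneg _).trans h3)
    _ = _ := by ring

theorem exists_weylOp [PolynormableSpace ℂ E] [IsUniformAddGroup E] [ContinuousSMul ℂ E]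
    [T2Space E] (hE : SeqComplete E) (hc : ∀ x, ContinuousOn (fun t => S t x) (Ici 0))
    {f : ℝ → ℂ} (hf : Continuous f)
    (hb : ∀ p : Seminorm ℂ E, Continuous p → ∃ ω : ℝ, 0 ≤ ω ∧ ∃ q : Seminorm ℂ E, Continuous q ∧
      (∀ t, 0 ≤ t → ∀ x, p (S t x) ≤ Real.exp (ω * t) * q x) ∧
      ∃ A : ℝ, ∀ s, 0 ≤ s → ‖f s‖ ≤ A * Real.exp (-(ω + 1) * s)) :
    ∃ L : E →L[ℂ] E, ∀ x, HasIntegralOn (fun t => fracInt α f t • S t x) (Ioi 0) (L x) := by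
  have hex : ∀ x, ∃ y, HasIntegralOn (fun t => fracInt α f t • S t x) (Ioi 0) y := by
    intro x
    -- Continuity of the weight needs only one decay rate, so any seminorm will do, for instance 0.
    obtain ⟨ω₀, hω₀, -, -, -, A₀, hA₀⟩ := hb 0 continuous_const
    -- The semigroup is continuous only on `[0, ∞)`; composing with `max t 0` extends the integrand
    -- continuously to the line.
    have hmax : Continuous fun t : ℝ => max t 0 := by fun_prop
    have hm : ∀ t : ℝ, max t 0 ∈ Ici (0 : ℝ) := fun t => le_max_right t 0
    have h1 : Continuous fun t => fracInt α f (max t 0) :=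
      (continuousOn_fracInt (by linarith) hf hA₀).comp_continuous hmax hm
    have h2 : Continuous fun t => S (max t 0) x := (hc x).comp_continuous hmax hm
    obtain ⟨y, hy⟩ := hE.exists_hasIntegralOn_Ioi (h1.smul h2) fun p hp => by
      obtain ⟨ω, hω, q, -, hS, A, hA⟩ := hb p hp
      refine ⟨A * weylMass α (ω + 1) * q x, fun t ht => ?_⟩
      change p (fracInt α f (max t 0) • S (max t 0) x) ≤ _
      rw [max_eq_left ht, map_smul_eq_mul]
      have h3 := norm_fracInt_le (α := α) (by linarith : 0 < ω + 1) hA ht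
      calc ‖fracInt α f t‖ * p (S t x) ≤
          (A * weylMass α (ω + 1) * Real.exp (-(ω + 1) * t)) * (Real.exp (ω * t) * q x) :=
            mul_le_mul h3 (hS t ht x) (apply_nonneg p _) ((norm_nonneg _).trans h3)
        _ = A * weylMass α (ω + 1) * q x * (Real.exp (-(ω + 1) * t) * Real.exp (ω * t)) := by ring
        _ = _ := by
          rw [← Real.exp_add]
          congr 2
          ring
    refine ⟨y, hy.congr measurableSet_Ioi fun t ht => ?_⟩
    change fracInt α f (max t 0) • S (max t 0) x = _
    rw [max_eq_left (le_of_lt (mem_Ioi.1 ht))]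
  choose L hL using hex
  let T : E →ₗ[ℂ] E :=
    { toFun := L
      map_add' := fun x y => (hL (x + y)).unique
        (((hL x).add (hL y)).congr measurableSet_Ioi fun t _ => by simp)
      map_smul' := fun c x => (hL (c • x)).unique
        (((hL x).const_smul c).congr measurableSet_Ioi fun t _ => by
          simp [smul_comm c]) }
  refine ⟨⟨T, continuous_of_seminorm_le T fun p hp => ?_⟩, hL⟩
  obtain ⟨ω, hω, q, hq, hS, A, hA⟩ := hb p hp
  have hA0 : 0 ≤ A := by simpa using (norm_nonneg _).trans (hA 0 le_rfl)
  let c : NNReal := ⟨A * weylMass α (ω + 1), mul_nonneg hA0 (weylMass_nonneg _ _)⟩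
  refine ⟨c • q, continuous_const_smul_seminorm hq c, fun x => ?_⟩
  exact seminorm_weylOp_le hp hω hS hA (hL x)

end WeylOperators

/-! ### Construction of `G` and its exponential estimates. -/

section Construction

/-- The operator `d/dt - c` on the Schwartz space. -/
def twistedDeriv (c : ℝ) : 𝓢(ℝ, ℂ) →L[ℂ] 𝓢(ℝ, ℂ) :=
  SchwartzMap.derivCLM ℂ ℂ - (c : ℂ) • ContinuousLinearMap.id ℂ _

/-- Conjugation by `e^{-ct}` turns `d/dt` into `d/dt - c`. Derivatives of `e^{-ct} φ` are thus
`e^{-ct}` times functions bounded by a Schwartz seminorm of `φ`, which is the decay that the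
operator estimates require. -/
theorem derivTest_expMul (c : ℝ) (φ : TestFn) :
    derivTest (expMul (-c) φ) = expMul (-c) (derivTest φ - (c : ℂ) • φ) := by
  ext t
  have h1 : HasDerivAt (fun t : ℝ => (Real.exp (-c * t) : ℂ)) ((-c * Real.exp (-c * t) : ℝ) : ℂ) t := by
    refine HasDerivAt.ofReal_comp ?_
    have := ((hasDerivAt_id t).const_mul (-c)).exp
    simpa [mul_comm] using this
  have h2 := h1.mul (hasDerivAt_testFn φ t)
  change deriv (fun t : ℝ => (Real.exp (-c * t) : ℂ) * φ t) t =
    (Real.exp (-c * t) : ℂ) * (derivTest φ t - (c : ℂ) * φ t)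
  rw [show deriv (fun t : ℝ => (Real.exp (-c * t) : ℂ) * φ t) t = _ from h2.deriv]
  push_cast
  ring

theorem toSchwartz_twisted (c : ℝ) (φ : TestFn) :
    toSchwartz (derivTest φ - (c : ℂ) • φ) = twistedDeriv c (toSchwartz φ) := by
  ext t
  rfl

theorem iterate_derivTest_expMul (c : ℝ) (n : ℕ) (φ : TestFn) (t : ℝ) :
    derivTest^[n] (expMul (-c) φ) t =
      (Real.exp (-c * t) : ℂ) * (twistedDeriv c ^ n) (toSchwartz φ) t := by
  induction n generalizing φ with
  | zero => rfl
  | succ n ih =>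
    rw [Function.iterate_succ_apply, derivTest_expMul, ih, toSchwartz_twisted, pow_succ,
      mul_apply_eq_comp]

/-- The continuous seminorm `φ ↦ sup_t |((d/dt - c)^n φ)(t)|` of the Schwartz space. -/
def twistedSeminorm (c : ℝ) (n : ℕ) : Seminorm ℂ 𝓢(ℝ, ℂ) :=
  (normSeminorm ℂ (BoundedContinuousFunction ℝ ℂ)).comp
    ((SchwartzMap.toBoundedContinuousFunctionCLM ℂ ℝ ℂ).comp (twistedDeriv c ^ n)).toLinearMap

theorem continuous_twistedSeminorm (c : ℝ) (n : ℕ) : Continuous (twistedSeminorm c n) :=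
  ((SchwartzMap.toBoundedContinuousFunctionCLM ℂ ℝ ℂ).comp (twistedDeriv c ^ n)).continuous.norm

theorem norm_le_twistedSeminorm (c : ℝ) (n : ℕ) (φ : 𝓢(ℝ, ℂ)) (t : ℝ) :
    ‖(twistedDeriv c ^ n) φ t‖ ≤ twistedSeminorm c n φ :=
  (SchwartzMap.toBoundedContinuousFunctionCLM ℂ ℝ ℂ ((twistedDeriv c ^ n) φ)).norm_coe_le_norm t

/-- The function `(-1)^n e^{-c t} ((d/dt - c)^n φ)(t)`. -/
def twistedFun (c : ℝ) (n : ℕ) (φ : 𝓢(ℝ, ℂ)) (t : ℝ) : ℂ :=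
  (-1) ^ n * ((Real.exp (-c * t) : ℂ) * (twistedDeriv c ^ n) φ t)

theorem continuous_twistedFun (c : ℝ) (n : ℕ) (φ : 𝓢(ℝ, ℂ)) : Continuous (twistedFun c n φ) := by
  have := ((twistedDeriv c ^ n) φ).continuous
  unfold twistedFun
  fun_prop

theorem norm_twistedFun_le (c : ℝ) (n : ℕ) (φ : 𝓢(ℝ, ℂ)) (t : ℝ) :
    ‖twistedFun c n φ t‖ ≤ twistedSeminorm c n φ * Real.exp (-c * t) := by
  rw [twistedFun, norm_mul, norm_mul, norm_pow, norm_neg, norm_one, one_pow, one_mul,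
    Complex.norm_real, Real.norm_of_nonneg (Real.exp_pos _).le, mul_comm]
  gcongr
  exact norm_le_twistedSeminorm c n φ t

variable {α : ℝ}

/-- The test function `(-1)^n φ^{(n)}`. -/
def signedDeriv (n : ℕ) (φ : TestFn) : TestFn := ((-1 : ℂ) ^ n) • derivTest^[n] φ

theorem signedDeriv_apply (n : ℕ) (φ : TestFn) (t : ℝ) :
    signedDeriv n φ t = (-1) ^ n * derivTest^[n] φ t := rfl

theorem norm_signedDeriv (n : ℕ) (φ : TestFn) (t : ℝ) :
    ‖signedDeriv n φ t‖ = ‖derivTest^[n] φ t‖ := by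
  simp [signedDeriv_apply]

theorem weylDeriv_eq_fracInt (φ : TestFn) (t : ℝ) :
    weylDeriv α φ t = fracInt α (signedDeriv ⌈α⌉₊ φ) t := by
  rw [weylDeriv_eq, ← fracInt_smul]
  rfl

theorem weylDeriv_expMul (c : ℝ) (φ : TestFn) (t : ℝ) :
    weylDeriv α (expMul (-c) φ) t = fracInt α (twistedFun c ⌈α⌉₊ (toSchwartz φ)) t := by
  rw [weylDeriv_eq_fracInt]
  congr 1
  ext s
  rw [signedDeriv_apply, iterate_derivTest_expMul, twistedFun]

theorem weylDeriv_add (φ ψ : TestFn) (t : ℝ) :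
    weylDeriv α ⇑(φ + ψ) t = weylDeriv α φ t + weylDeriv α ψ t := by
  have hint : ∀ φ : TestFn, Integrable (fun u => φ (t + u)) (weylMeasure α) := fun φ =>
    Integrable.mono' ((integrable_exp_weylMeasure α one_pos).const_mul
      (supNorm (expMul 1 φ) * Real.exp (-1 * t)))
      (by fun_prop : Continuous fun u => φ (t + u)).aestronglyMeasurable
      (Eventually.of_forall fun u => by
        rw [mul_assoc, ← Real.exp_add, ← mul_add]
        exact norm_testFn_le_exp 1 φ _)
  simp only [weylDeriv_eq, iterate_derivTest_add, ← mul_add]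
  congr 1
  exact integral_add (hint _) (hint _)

theorem weylDeriv_smul (c : ℂ) (φ : TestFn) (t : ℝ) :
    weylDeriv α ⇑(c • φ) t = c * weylDeriv α φ t := by
  have : fracInt α ⇑(c • derivTest^[⌈α⌉₊] φ) t =
    c * fracInt α (derivTest^[⌈α⌉₊] φ) t := fracInt_smul c t
  rw [weylDeriv_eq, weylDeriv_eq, iterate_derivTest_smul, this]
  ring

variable {E : Type*} [AddCommGroup E] [Module ℂ E] [UniformSpace E]

/-- Every continuous seminorm grows at most exponentially along `S`. -/
def ExpBounded (S : ℝ → E →L[ℂ] E) : Prop :=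
  ∀ p : Seminorm ℂ E, Continuous p → ∃ ω : ℝ, 0 ≤ ω ∧ ∃ q : Seminorm ℂ E, Continuous q ∧
    ∀ t, 0 ≤ t → ∀ x, p (S t x) ≤ Real.exp (ω * t) * q x

theorem QExpEquicontinuous.expBounded {S : ℝ → E →L[ℂ] E} (h : QExpEquicontinuous S) :
    ExpBounded S := by
  intro p hp
  obtain ⟨M, hM, ω, hω, q, hq, hle⟩ := h p hp
  let c : NNReal := ⟨M, by linarith⟩
  refine ⟨ω, hω, c • q, continuous_const_smul_seminorm hq c, fun t ht x => ?_⟩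
  refine (hle t ht x).trans_eq ?_
  change M * Real.exp (ω * t) * q x = Real.exp (ω * t) * (M * q x)
  ring

theorem ExpEquicontinuous.exists_nonneg {S : ℝ → E →L[ℂ] E} (h : ExpEquicontinuous S) :
    ∃ ω : ℝ, 0 ≤ ω ∧ ∀ p : Seminorm ℂ E, Continuous p → ∃ q : Seminorm ℂ E, Continuous q ∧
      ∀ t, 0 ≤ t → ∀ x, p (S t x) ≤ Real.exp (ω * t) * q x := by
  obtain ⟨ω, h⟩ := h
  refine ⟨max ω 0, le_max_right _ _, fun p hp => ?_⟩
  obtain ⟨q, hq, hle⟩ := h p hp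
  refine ⟨q, hq, fun t ht x => (hle t ht x).trans ?_⟩
  gcongr
  exact le_max_left _ _

theorem ExpEquicontinuous.expBounded {S : ℝ → E →L[ℂ] E} (h : ExpEquicontinuous S) :
    ExpBounded S := by
  obtain ⟨ω, hω, h⟩ := h.exists_nonneg
  exact fun p hp => ⟨ω, hω, h p hp⟩

variable {S : ℝ → E →L[ℂ] E}

/-- A test function decays at every exponential rate, so the growth type may depend on the seminorm
and both kinds of semigroup are covered at once. -/
theorem exists_distribution [PolynormableSpace ℂ E] [IsUniformAddGroup E] [ContinuousSMul ℂ E]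
    [T2Space E] (hE : SeqComplete E) (hc : ∀ x, ContinuousOn (fun t => S t x) (Ici 0))
    (hS : ExpBounded S) :
    ∃ G : TestFn →L[ℂ] E →L[ℂ] E, ∀ (φ : TestFn) x,
      HasIntegralOn (fun t => weylDeriv α φ t • S t x) (Ioi 0) (G φ x) := by
  have hbd : ∀ (ω : ℝ) (φ : TestFn) (s : ℝ),
      ‖signedDeriv ⌈α⌉₊ φ s‖ ≤
        expSeminorm (ω + 1) ⌈α⌉₊ φ * Real.exp (-(ω + 1) * s) := by
    intro ω φ s
    rw [norm_signedDeriv, expSeminorm_apply]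
    exact norm_testFn_le_exp _ _ _
  have hex : ∀ φ : TestFn, ∃ L : E →L[ℂ] E, ∀ x,
      HasIntegralOn (fun t => weylDeriv α φ t • S t x) (Ioi 0) (L x) := by
    intro φ
    simp only [weylDeriv_eq_fracInt]
    refine exists_weylOp hE hc (TestFunction.continuous _) fun p hp => ?_
    obtain ⟨ω, hω, q, hq, hle⟩ := hS p hp
    exact ⟨ω, hω, q, hq, hle, _, fun s _ => hbd ω φ s⟩
  choose L hL using hex
  let T : TestFn →ₗ[ℂ] E →L[ℂ] E :=
    { toFun := L
      map_add' := fun φ ψ => by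
        ext x
        exact (hL (φ + ψ) x).unique (((hL φ x).add (hL ψ x)).congr measurableSet_Ioi fun t _ => by
          rw [weylDeriv_add, add_smul])
      map_smul' := fun c φ => by
        ext x
        exact (hL (c • φ) x).unique (((hL φ x).const_smul c).congr measurableSet_Ioi fun t _ => by
          rw [weylDeriv_smul, mul_smul]) }
  refine ⟨⟨T, continuous_operator_of_seminorm_le T fun p hp => ?_⟩, hL⟩
  obtain ⟨ω, hω, q, hq, hle⟩ := hS p hp
  let c : NNReal := ⟨weylMass α (ω + 1), weylMass_nonneg _ _⟩
  refine ⟨expSeminorm (ω + 1) ⌈α⌉₊, continuous_expSeminorm _ _, c • q,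
    continuous_const_smul_seminorm hq c, fun φ x => ?_⟩
  have h := hL φ x
  simp only [weylDeriv_eq_fracInt] at h
  refine (seminorm_weylOp_le hp hω hle (fun s _ => hbd ω φ s) h).trans_eq ?_
  change _ = _ * (weylMass α (ω + 1) * q x)
  ring

variable [IsUniformAddGroup E] [ContinuousSMul ℂ E] {G : TestFn →L[ℂ] E →L[ℂ] E}

theorem seminorm_distribution_le [PolynormableSpace ℂ E]
    (hG : ∀ (φ : TestFn) x, HasIntegralOn (fun t => weylDeriv α φ t • S t x) (Ioi 0) (G φ x))
    {p q : Seminorm ℂ E} (hp : Continuous p) {ω A : ℝ} (hω : 0 ≤ ω)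
    (hS : ∀ t, 0 ≤ t → ∀ x, p (S t x) ≤ Real.exp (ω * t) * q x) {φ : TestFn}
    (hφ : ∀ s, 0 ≤ s → ‖derivTest^[⌈α⌉₊] φ s‖ ≤ A * Real.exp (-(ω + 1) * s)) (x : E) :
    p (G φ x) ≤ A * weylMass α (ω + 1) * q x := by
  have h := hG φ x
  simp only [weylDeriv_eq_fracInt] at h
  exact seminorm_weylOp_le hp hω hS (fun s hs => (norm_signedDeriv _ _ _).trans_le (hφ s hs)) h

theorem norm_iterate_derivTest_expMul_le (c : ℝ) (n : ℕ) (φ : TestFn) (s : ℝ) :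
    ‖derivTest^[n] (expMul (-c) φ) s‖ ≤ twistedSeminorm c n (toSchwartz φ) * Real.exp (-c * s) := by
  have := norm_twistedFun_le c n (toSchwartz φ) s
  rwa [twistedFun, ← iterate_derivTest_expMul, norm_mul, norm_pow, norm_neg, norm_one, one_pow,
    one_mul] at this

theorem isQExponential_of_expBounded [PolynormableSpace ℂ E]
    (hG : ∀ (φ : TestFn) x, HasIntegralOn (fun t => weylDeriv α φ t • S t x) (Ioi 0) (G φ x))
    (hS : ExpBounded S) : IsQExponential G := by
  intro p hp
  obtain ⟨ω, hω, q, hq, hle⟩ := hS p hp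
  refine ⟨ω + 1, by linarith, fun B hB => ?_⟩
  obtain ⟨M, hM, hBM⟩ := bounded_on_of_isVonNBounded hB hq
  have hw := weylMass_nonneg α (ω + 1)
  -- The summand 1 only serves the normalisation that the constant be at least 1.
  refine ⟨weylMass α (ω + 1) * M + 1, by nlinarith [mul_nonneg hw hM],
    twistedSeminorm (ω + 1) ⌈α⌉₊, continuous_twistedSeminorm _ _, fun φ x hx => ?_⟩
  have hN := apply_nonneg (twistedSeminorm (ω + 1) ⌈α⌉₊) (toSchwartz φ)
  refine (seminorm_distribution_le hG hp hω hle
    (fun s _ => norm_iterate_derivTest_expMul_le (ω + 1) _ φ s) x).trans ?_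
  calc twistedSeminorm (ω + 1) ⌈α⌉₊ (toSchwartz φ) * weylMass α (ω + 1) * q x
      ≤ twistedSeminorm (ω + 1) ⌈α⌉₊ (toSchwartz φ) * weylMass α (ω + 1) * M := by
        gcongr
        exact hBM x hx
    _ ≤ _ := by nlinarith

/-- The integral formula for `G (e^{-(ω+1)t} φ)` makes sense for Schwartz `φ`. One weight must serve
all seminorms simultaneously, which is where the common `ω` is needed. -/
theorem isExponential_of_expEquicontinuous [PolynormableSpace ℂ E] [T2Space E] (hE : SeqComplete E)
    (hc : ∀ x, ContinuousOn (fun t => S t x) (Ici 0))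
    (hG : ∀ (φ : TestFn) x, HasIntegralOn (fun t => weylDeriv α φ t • S t x) (Ioi 0) (G φ x))
    (hS : ExpEquicontinuous S) : IsExponential G := by
  obtain ⟨ω, hω, hS⟩ := hS.exists_nonneg
  have hω1 : 0 < ω + 1 := by linarith
  set n := ⌈α⌉₊ with hn
  have hbd : ∀ (φ : 𝓢(ℝ, ℂ)) (s : ℝ), 0 ≤ s → ‖twistedFun (ω + 1) n φ s‖ ≤
      twistedSeminorm (ω + 1) n φ * Real.exp (-(ω + 1) * s) := fun φ s _ =>
    norm_twistedFun_le _ _ _ _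
  have hex : ∀ φ : 𝓢(ℝ, ℂ), ∃ L : E →L[ℂ] E, ∀ x,
      HasIntegralOn (fun t => fracInt α (twistedFun (ω + 1) n φ) t • S t x) (Ioi 0) (L x) := by
    intro φ
    refine exists_weylOp hE hc (continuous_twistedFun _ _ _) fun p hp => ?_
    obtain ⟨q, hq, hle⟩ := hS p hp
    exact ⟨ω, hω, q, hq, hle, _, hbd φ⟩
  choose L hL using hex
  let T : 𝓢(ℝ, ℂ) →ₗ[ℂ] E →L[ℂ] E :=
    { toFun := L
      map_add' := fun φ ψ => by
        ext x
        refine (hL (φ + ψ) x).unique (((hL φ x).add (hL ψ x)).congr measurableSet_Ioi fun t ht => ?_)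
        rw [← add_smul, ← fracInt_add hω1 (continuous_twistedFun _ _ _) (hbd φ)
          (continuous_twistedFun _ _ _) (hbd ψ) (le_of_lt ht)]
        congr 2
        ext s
        simp only [Pi.add_apply, twistedFun, map_add, add_apply]
        ring
      map_smul' := fun c φ => by
        ext x
        refine (hL (c • φ) x).unique (((hL φ x).const_smul c).congr measurableSet_Ioi fun t ht => ?_)
        rw [← mul_smul, ← fracInt_smul]
        congr 2
        ext s
        simp only [Pi.smul_apply, twistedFun, map_smul, smul_apply, smul_eq_mul]
        ring }
  refine ⟨ω + 1, ⟨T, continuous_operator_of_seminorm_le T fun p hp => ?_⟩, fun φ => ?_⟩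
  · obtain ⟨q, hq, hle⟩ := hS p hp
    let c : NNReal := ⟨weylMass α (ω + 1), weylMass_nonneg _ _⟩
    refine ⟨twistedSeminorm (ω + 1) n, continuous_twistedSeminorm _ _, c • q,
      continuous_const_smul_seminorm hq c, fun φ x => ?_⟩
    refine (seminorm_weylOp_le hp hω hle (hbd φ) (hL φ x)).trans_eq ?_
    change _ = _ * (weylMass α (ω + 1) * q x)
    ring
  · ext x
    refine (hL (toSchwartz φ) x).unique ((hG (expMul (-(ω + 1)) φ) x).congr measurableSet_Ioi
      fun t _ => ?_)
    rw [weylDeriv_expMul]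

end Construction

/-! ### Supports and regularity of Weyl derivatives. -/

section Supports

/-- The endpoint 0 is included because the right derivative already determines the derivative. Hence
`G φ` depends only on `φ` restricted to `[0, ∞)`. -/
theorem derivTest_eq_zero_of_Ici {φ : TestFn} (h : ∀ s, 0 ≤ s → φ s = 0) {s : ℝ} (hs : 0 ≤ s) :
    derivTest φ s = 0 := by
  have h1 := (hasDerivAt_testFn φ s).hasDerivWithinAt (s := Ici s)
  have h2 : HasDerivWithinAt φ 0 (Ici s) s :=
    (hasDerivWithinAt_const s (Ici s) (0 : ℂ)).congr (fun t ht => h t (hs.trans ht)) (h s hs)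
  exact (uniqueDiffWithinAt_Ici s).eq_deriv _ h1 h2

theorem iterate_derivTest_eq_zero_of_Ici (n : ℕ) {φ : TestFn} (h : ∀ s, 0 ≤ s → φ s = 0) {s : ℝ}
    (hs : 0 ≤ s) : derivTest^[n] φ s = 0 := by
  induction n generalizing φ with
  | zero => exact h s hs
  | succ n ih => exact ih fun t ht => derivTest_eq_zero_of_Ici h ht

theorem derivTest_eq_zero_of_isOpen {U : Set ℝ} (hU : IsOpen U) {φ : TestFn}
    (h : ∀ s ∈ U, φ s = 0) {s : ℝ} (hs : s ∈ U) : derivTest φ s = 0 := by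
  have h1 : (φ : ℝ → ℂ) =ᶠ[𝓝 s] fun _ => 0 := by
    filter_upwards [hU.mem_nhds hs] with t ht using h t ht
  rw [derivTest_apply, h1.deriv_eq, deriv_const]

theorem iterate_derivTest_eq_zero_of_isOpen {U : Set ℝ} (hU : IsOpen U) (n : ℕ) {φ : TestFn}
    (h : ∀ s ∈ U, φ s = 0) {s : ℝ} (hs : s ∈ U) : derivTest^[n] φ s = 0 := by
  induction n generalizing φ with
  | zero => exact h s hs
  | succ n ih => exact ih fun t ht => derivTest_eq_zero_of_isOpen hU h ht

/-- `φ` vanishes outside of `[-b, b]`. -/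
def SupportedIn (b : ℝ) (φ : TestFn) : Prop := ∀ s, b < |s| → φ s = 0

theorem exists_supportedIn (φ : TestFn) : ∃ b, 0 ≤ b ∧ SupportedIn b φ := by
  obtain ⟨R, hR⟩ := φ.hasCompactSupport.isCompact.isBounded.subset_closedBall (0 : ℝ)
  refine ⟨|R|, abs_nonneg R, fun s hs => image_eq_zero_of_notMem_tsupport fun hmem => ?_⟩
  have := hR hmem
  rw [Metric.mem_closedBall, Real.dist_eq, sub_zero] at this
  linarith [le_abs_self R]

theorem SupportedIn.mono {b c : ℝ} {φ : TestFn} (h : SupportedIn b φ) (hbc : b ≤ c) :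
    SupportedIn c φ := fun s hs => h s (hbc.trans_lt hs)

theorem SupportedIn.iterate_derivTest {b : ℝ} {φ : TestFn} (h : SupportedIn b φ) (n : ℕ) :
    SupportedIn b (derivTest^[n] φ) := fun _ hs =>
  iterate_derivTest_eq_zero_of_isOpen (isOpen_lt continuous_const continuous_abs) n h hs

theorem SupportedIn.derivTest {b : ℝ} {φ : TestFn} (h : SupportedIn b φ) :
    SupportedIn b (derivTest φ) := h.iterate_derivTest 1

theorem SupportedIn.sub {b : ℝ} {φ ψ : TestFn} (h : SupportedIn b φ) (h' : SupportedIn b ψ) :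
    SupportedIn b (φ - ψ) := fun s hs => by
  change φ s - ψ s = 0
  rw [h s hs, h' s hs, sub_zero]

theorem SupportedIn.smul {b : ℝ} {φ : TestFn} (h : SupportedIn b φ) (c : ℂ) :
    SupportedIn b (c • φ) := fun s hs => by
  change c * φ s = 0
  rw [h s hs, mul_zero]

variable {α : ℝ}

theorem weylDeriv_eq_zero {b : ℝ} {φ : TestFn} (h : ∀ s, b < s → φ s = 0) {t : ℝ} (ht : b < t) :
    weylDeriv α φ t = 0 := by
  rw [weylDeriv_eq, fracInt, integral_eq_zero_of_ae, mul_zero]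
  filter_upwards [ae_weylMeasure_nonneg α] with u hu
  exact iterate_derivTest_eq_zero_of_isOpen isOpen_Ioi _ h (show b < t + u by linarith)

theorem hasDerivAt_weylDeriv (φ : TestFn) (t : ℝ) :
    HasDerivAt (weylDeriv α φ) (weylDeriv α (derivTest φ) t) t := by
  have h := (hasDerivAt_fracInt (α := α) (derivTest^[⌈α⌉₊] φ) t).const_mul ((-1) ^ ⌈α⌉₊)
  rw [← Function.iterate_succ_apply' derivTest, Function.iterate_succ_apply] at h
  rw [weylDeriv_eq, show weylDeriv α φ = fun t => _ from funext (weylDeriv_eq φ)]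
  exact h

theorem continuous_weylDeriv (φ : TestFn) : Continuous (weylDeriv α φ) :=
  continuous_iff_continuousAt.2 fun t => (hasDerivAt_weylDeriv φ t).continuousAt

theorem integrableOn_weylDeriv_mul (φ : TestFn) {g : ℝ → ℂ} (hg : ContinuousOn g (Ici 0)) :
    IntegrableOn (fun t => weylDeriv α φ t * g t) (Ioi 0) := by
  obtain ⟨b, hb, hφ⟩ := exists_supportedIn φ
  rw [← Ioc_union_Ioi_eq_Ioi hb, integrableOn_union]
  constructor
  · refine (ContinuousOn.integrableOn_Icc ?_).mono_set Ioc_subset_Icc_self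
    exact (continuous_weylDeriv φ).continuousOn.mul (hg.mono Icc_subset_Ici_self)
  · refine (integrableOn_zero (s := Ioi b)).congr_fun (fun t ht => ?_) measurableSet_Ioi
    rw [weylDeriv_eq_zero (fun s hs => hφ s (hs.trans_le (le_abs_self s))) ht, zero_mul]

end Supports

/-! ### Relations between `G`, `C` and `A`. -/

section OperatorRelations

variable {E : Type*} [AddCommGroup E] [Module ℂ E] [UniformSpace E] [IsUniformAddGroup E]
  [ContinuousSMul ℂ E] {C : E →L[ℂ] E} {S : ℝ → E →L[ℂ] E} {α : ℝ}
  {A : E →ₗ.[ℂ] E} {G : TestFn →L[ℂ] E →L[ℂ] E}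

/-- Integration by parts replaces `S(t)x` by its primitive, on which `A` is known to act. The
boundary terms vanish since the primitive is 0 at 0 and the weight is 0 for large `t`. -/
theorem hasIntegralOn_primitive
    (hG : ∀ (φ : TestFn) x, HasIntegralOn (fun t => weylDeriv α φ t • S t x) (Ioi 0) (G φ x))
    (hc : ∀ x, ContinuousOn (fun t => S t x) (Ici 0)) (φ : TestFn) (x : E) {U : ℝ → E}
    (hU : ∀ t, 0 ≤ t → HasIntegralOn (fun s => S s x) (Ioc 0 t) (U t)) :
    HasIntegralOn (fun t => (-weylDeriv α (derivTest φ) t) • U t) (Ioi 0) (G φ x) := by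
  intro ℓ
  let g : ℝ → ℂ := fun t => ℓ (S (max t 0) x)
  have hg : Continuous g := ℓ.continuous.comp
    ((hc x).comp_continuous (by fun_prop : Continuous fun t : ℝ => max t 0) fun t => le_max_right t 0)
  have hgS : ∀ t, 0 ≤ t → g t = ℓ (S t x) := fun t ht => by simp only [g, max_eq_left ht]
  let I : ℝ → ℂ := fun t => ∫ s in (0 : ℝ)..t, g s
  have hI : ∀ t, HasDerivAt I (g t) t := fun t => hg.integral_hasStrictDerivAt 0 t |>.hasDerivAt
  have hIc : Continuous I := continuous_iff_continuousAt.2 fun t => (hI t).continuousAt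
  have hIU : ∀ t, 0 ≤ t → ℓ (U t) = I t := by
    intro t ht
    rw [← (hU t ht ℓ).2]
    simp only [I]
    rw [intervalIntegral.integral_of_le ht]
    exact setIntegral_congr_fun measurableSet_Ioc fun s hs => (hgS s hs.1.le).symm
  have hφ0 : Tendsto (weylDeriv α φ * I) (𝓝[>] 0) (𝓝 0) := by
    have h1 : Continuous (weylDeriv α φ * I) := (continuous_weylDeriv φ).mul hIc
    have h2 := (h1.tendsto 0).mono_left (nhdsWithin_le_nhds (s := Ioi 0))
    simpa [I] using h2
  have htop : Tendsto (weylDeriv α φ * I) atTop (𝓝 0) := by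
    obtain ⟨b, -, hb⟩ := exists_supportedIn φ
    refine tendsto_const_nhds.congr' ?_
    filter_upwards [eventually_gt_atTop b] with t ht
    rw [Pi.mul_apply, weylDeriv_eq_zero (fun s hs => hb s (hs.trans_le (le_abs_self s))) ht, zero_mul]
  have hW' := integrableOn_weylDeriv_mul (α := α) (derivTest φ) hIc.continuousOn
  have hparts := integral_Ioi_mul_deriv_eq_deriv_mul (fun t _ => hasDerivAt_weylDeriv (α := α) φ t)
    (fun t _ => hI t) (integrableOn_weylDeriv_mul φ hg.continuousOn) hW' hφ0 htop
  have heq : EqOn (fun t => -(weylDeriv α (derivTest φ) t * I t))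
      (fun t => ℓ ((-weylDeriv α (derivTest φ) t) • U t)) (Ioi 0) := by
    intro t ht
    simp only
    rw [map_smul, hIU t (le_of_lt ht), smul_eq_mul, neg_mul]
  refine ⟨hW'.neg.congr_fun heq measurableSet_Ioi, ?_⟩
  rw [← setIntegral_congr_fun measurableSet_Ioi heq, integral_neg, ← (hG φ x ℓ).2]
  have h3 : EqOn (fun t => ℓ (weylDeriv α φ t • S t x)) (fun t => weylDeriv α φ t * g t) (Ioi 0) := by
    intro t ht
    simp only
    rw [map_smul, hgS t (le_of_lt ht), smul_eq_mul]
  rw [setIntegral_congr_fun measurableSet_Ioi h3, hparts]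
  ring

variable [PolynormableSpace ℂ E]

theorem distribution_eq_zero_of_Ici [T2Space E]
    (hG : ∀ (φ : TestFn) x, HasIntegralOn (fun t => weylDeriv α φ t • S t x) (Ioi 0) (G φ x))
    (hS : ExpBounded S) {φ : TestFn} (h : ∀ s, 0 ≤ s → φ s = 0) : G φ = 0 := by
  ext x
  refine eq_zero_of_seminorm_eq_zero fun p hp => le_antisymm ?_ (apply_nonneg p _)
  obtain ⟨ω, hω, q, hq, hle⟩ := hS p hp
  refine (seminorm_distribution_le hG hp hω hle (A := 0) (fun s hs => ?_) x).trans (by simp)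
  rw [iterate_derivTest_eq_zero_of_Ici _ h hs]
  simp

/-- On a fixed compact support the exponential weight is bounded, so `G` has order at most `⌈α⌉`
with respect to every seminorm. -/
theorem exists_seminorm_distribution_le
    (hG : ∀ (φ : TestFn) x, HasIntegralOn (fun t => weylDeriv α φ t • S t x) (Ioi 0) (G φ x))
    (hS : ExpBounded S) {p : Seminorm ℂ E} (hp : Continuous p) (b : ℝ) :
    ∃ q : Seminorm ℂ E, Continuous q ∧ ∀ φ, SupportedIn b φ → ∀ x,
      p (G φ x) ≤ supNorm (derivTest^[⌈α⌉₊] φ) * q x := by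
  obtain ⟨ω, hω, q, hq, hle⟩ := hS p hp
  let c : NNReal := ⟨Real.exp ((ω + 1) * b) * weylMass α (ω + 1),
    mul_nonneg (Real.exp_pos _).le (weylMass_nonneg _ _)⟩
  refine ⟨c • q, continuous_const_smul_seminorm hq c, fun φ hφ x => ?_⟩
  have h := seminorm_distribution_le hG hp hω hle
    (A := supNorm (derivTest^[⌈α⌉₊] φ) * Real.exp ((ω + 1) * b)) (φ := φ) (fun s hs => ?_) x
  · refine h.trans_eq ?_
    change _ = _ * (Real.exp ((ω + 1) * b) * weylMass α (ω + 1) * q x)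
    ring
  · have hN := supNorm_nonneg (derivTest^[⌈α⌉₊] φ)
    by_cases hsb : b < s
    · rw [hφ.iterate_derivTest _ s (hsb.trans_le (le_abs_self s)), norm_zero]
      positivity
    · refine (norm_apply_le_supNorm _ s).trans ?_
      rw [mul_assoc, ← Real.exp_add]
      refine le_mul_of_one_le_right hN (Real.one_le_exp ?_)
      have : 0 ≤ (ω + 1) * (b - s) := mul_nonneg (by linarith) (by linarith)
      linarith

theorem distribution_comm [T2Space E]
    (hG : ∀ (φ : TestFn) x, HasIntegralOn (fun t => weylDeriv α φ t • S t x) (Ioi 0) (G φ x))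
    (hA : IsSubgenerator C α S A) (φ : TestFn) (x : E) : G φ (C x) = C (G φ x) :=
  (hG φ (C x)).unique (((hG φ x).map C).congr measurableSet_Ioi fun t ht => by
    rw [map_smul, hA.comm t (le_of_lt ht)])

theorem distribution_comm_graph
    (hG : ∀ (φ : TestFn) x, HasIntegralOn (fun t => weylDeriv α φ t • S t x) (Ioi 0) (G φ x))
    (hA : IsSubgenerator C α S A) (φ : TestFn) {x y : E} (hxy : (x, y) ∈ A.graph) :
    (G φ x, G φ y) ∈ A.graph :=
  (hG φ x).mem_graph hA.closed (hG φ y) fun t ht =>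
    A.graph.smul_mem (weylDeriv α φ t) (hA.comm_op t (le_of_lt ht) x y hxy)

/-- The key identity. Apply the closed operator `A` under the integral `G φ x = -∫ W_+^α φ' U`, with
`U` the primitive of `S x` and `A U = S x - Θ_α C x`: the first term gives `-G(φ')x`, the second
`-φ(0) C x`. -/
theorem distribution_mem_graph
    (hα : 0 ≤ α)
    (hG : ∀ (φ : TestFn) x, HasIntegralOn (fun t => weylDeriv α φ t • S t x) (Ioi 0) (G φ x))
    (hA : IsSubgenerator C α S A) (φ : TestFn) (x : E) :
    (G φ x, -G (derivTest φ) x - φ 0 • C x) ∈ A.graph := by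
  choose! U hU hUA using fun t (ht : 0 ≤ t) => hA.eq_op t ht x
  have hΘ : ContinuousOn (Theta α) (Ici 0) := by
    refine Continuous.continuousOn ?_
    unfold Theta
    have := Real.continuous_rpow_const hα
    fun_prop
  have h1 : HasIntegralOn (fun t => (weylDeriv α (derivTest φ) t * Theta α t) • C x) (Ioi 0)
      (-φ 0 • C x) := by
    intro ℓ
    have hint := integrableOn_weylDeriv_mul (α := α) (derivTest φ) hΘ
    simp only [map_smul, smul_eq_mul]
    refine ⟨hint.mul_const _, ?_⟩
    rw [integral_mul_const, ← integral_Theta_mul_weylDeriv hα φ]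
    simp only [mul_comm]
  have h2 := (h1.sub (hG (derivTest φ) x)).congr measurableSet_Ioi
    (g := fun t => (-weylDeriv α (derivTest φ) t) • (S t x - Theta α t • C x)) fun t _ => by
      rw [smul_sub, neg_smul, neg_smul, smul_smul]
      abel
  have h3 := (hasIntegralOn_primitive hG hA.continuousOn φ x hU).mem_graph hA.closed h2
    fun t ht => A.graph.smul_mem _ (hUA t (le_of_lt ht))
  have : -φ 0 • C x - G (derivTest φ) x = -G (derivTest φ) x - φ 0 • C x := by
    rw [neg_smul]
    abel
  rwa [this] at h3

end OperatorRelations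

/-! ### The product `*₀`: Leibniz rule, supports and norm bounds. -/

section ConvolutionAlgebra

theorem intervalIntegrable_conv₀ (φ ψ : TestFn) (t a b : ℝ) :
    IntervalIntegrable (fun s => φ (t - s) * ψ s) volume a b :=
  (by fun_prop : Continuous fun s => φ (t - s) * ψ s).intervalIntegrable _ _

theorem conv₀_comm (φ ψ : TestFn) : conv₀ φ ψ = conv₀ ψ φ := by
  ext t
  have := intervalIntegral.integral_comp_sub_left (fun s => φ s * ψ (t - s)) t (a := 0) (b := t)
  simp only [sub_self, sub_zero, sub_sub_cancel] at this
  simp only [conv₀_apply, conv₀Fun]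
  rw [this]
  simp only [mul_comm]

theorem conv₀_add_left (φ φ' ψ : TestFn) : conv₀ (φ + φ') ψ = conv₀ φ ψ + conv₀ φ' ψ := by
  ext t
  change ∫ s in (0 : ℝ)..t, (φ (t - s) + φ' (t - s)) * ψ s =
    (∫ s in (0 : ℝ)..t, φ (t - s) * ψ s) + ∫ s in (0 : ℝ)..t, φ' (t - s) * ψ s
  rw [← intervalIntegral.integral_add (intervalIntegrable_conv₀ _ _ _ _ _)
    (intervalIntegrable_conv₀ _ _ _ _ _)]
  simp only [add_mul]

theorem conv₀_smul_left (c : ℂ) (φ ψ : TestFn) : conv₀ (c • φ) ψ = c • conv₀ φ ψ := by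
  ext t
  change ∫ s in (0 : ℝ)..t, (c * φ (t - s)) * ψ s = c * ∫ s in (0 : ℝ)..t, φ (t - s) * ψ s
  rw [← intervalIntegral.integral_const_mul]
  simp only [mul_assoc]

theorem conv₀_add_right (φ ψ ψ' : TestFn) : conv₀ φ (ψ + ψ') = conv₀ φ ψ + conv₀ φ ψ' := by
  rw [conv₀_comm, conv₀_add_left, conv₀_comm ψ, conv₀_comm ψ']

theorem conv₀_smul_right (c : ℂ) (φ ψ : TestFn) : conv₀ φ (c • ψ) = c • conv₀ φ ψ := by
  rw [conv₀_comm, conv₀_smul_left, conv₀_comm ψ]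

theorem integral_Iio_mul_deriv_sub (φ ψ : TestFn) (t : ℝ) :
    ∫ u in Iic (0 : ℝ), (ψ (t - u) * derivTest φ u - derivTest ψ (t - u) * φ u) = φ 0 * ψ t := by
  have hd : ∀ u ∈ Iic (0 : ℝ), HasDerivAt (fun u => ψ (t - u) * φ u)
      (ψ (t - u) * derivTest φ u - derivTest ψ (t - u) * φ u) u := by
    intro u _
    have h1 : HasDerivAt (fun u => ψ (t - u)) (-derivTest ψ (t - u)) u := by
      exact (hasDerivAt_testFn ψ (t - u)).comp_const_sub t u
    refine (h1.mul (hasDerivAt_testFn φ u)).congr_deriv ?_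
    ring
  have hint : Integrable (fun u => ψ (t - u) * derivTest φ u - derivTest ψ (t - u) * φ u) :=
    (Continuous.integrable_of_hasCompactSupport (by fun_prop)
      (derivTest φ).hasCompactSupport.mul_left).sub
    (Continuous.integrable_of_hasCompactSupport (by fun_prop) φ.hasCompactSupport.mul_left)
  have hlim : Tendsto (fun u => ψ (t - u) * φ u) atBot (𝓝 0) := by
    have : HasCompactSupport fun u => ψ (t - u) * φ u := φ.hasCompactSupport.mul_left
    exact this.is_zero_at_infty.mono_left atBot_le_cocompact
  rw [integral_Iic_of_hasDerivAt_of_tendsto' hd hint.integrableOn hlim]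
  simp [mul_comm]

/-- In the two-convolution form the derivative falls on `φ` in one term and on `ψ` in the other.
Moving it from `ψ` to `φ` over the half-line `u ≤ 0` produces the boundary term `φ(0) ψ`. -/
theorem derivTest_conv₀_left (φ ψ : TestFn) :
    derivTest (conv₀ φ ψ) = conv₀ (derivTest φ) ψ + φ 0 • ψ := by
  ext t
  have hψi := ((integrable_testFn ψ).indicator (measurableSet_Ioi (a := (0 : ℝ)))).locallyIntegrable
  have hφi := ((integrable_testFn φ).indicator (measurableSet_Iio (a := (0 : ℝ)))).locallyIntegrable
  have h1 := φ.hasCompactSupport.hasDerivAt_convolution_right (ContinuousLinearMap.mul ℝ ℂ)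
    hψi (φ.contDiff.of_le (by simp)) t
  have h2 := ψ.hasCompactSupport.hasDerivAt_convolution_left (ContinuousLinearMap.mul ℝ ℂ)
    (ψ.contDiff.of_le (by simp)) hφi t
  have h3 := h1.sub h2
  rw [← conv₀Fun_eq] at h3
  have h4 : conv₀ (derivTest φ) ψ t = _ := congrFun (conv₀Fun_eq (derivTest φ) ψ) t
  change deriv (conv₀Fun φ ψ) t = conv₀ (derivTest φ) ψ t + φ 0 * ψ t
  rw [h3.deriv, h4, ← integral_Iio_mul_deriv_sub, Pi.sub_apply, sub_add]
  refine congrArg (_ - ·) ?_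
  change convolution (derivTest ψ) ((Iio (0 : ℝ)).indicator φ) (ContinuousLinearMap.mul ℝ ℂ) volume t = _
  rw [integral_Iic_eq_integral_Iio, integral_sub]
  · have e : ∀ f g : TestFn, (convolution (g : ℝ → ℂ) ((Iio (0 : ℝ)).indicator f)
        (ContinuousLinearMap.mul ℝ ℂ) volume) t = ∫ u in Iio (0 : ℝ), g (t - u) * f u := by
      intro f g
      rw [convolution_eq_swap, ← integral_indicator measurableSet_Iio]
      congr 1
      ext u
      by_cases hu : u ∈ Iio (0 : ℝ)
      · simp [indicator_of_mem hu]
      · simp [indicator_of_notMem hu]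
    rw [e (derivTest φ) ψ, sub_sub_cancel]
    exact e φ (derivTest ψ)
  · exact (Continuous.integrable_of_hasCompactSupport (by fun_prop)
      (derivTest φ).hasCompactSupport.mul_left).integrableOn
  · exact (Continuous.integrable_of_hasCompactSupport (by fun_prop)
      φ.hasCompactSupport.mul_left).integrableOn

theorem derivTest_conv₀_right (φ ψ : TestFn) :
    derivTest (conv₀ φ ψ) = conv₀ φ (derivTest ψ) + ψ 0 • φ := by
  rw [conv₀_comm, derivTest_conv₀_left, conv₀_comm]

theorem conv₀_eq_zero_of_Ici {φ : TestFn} (ψ : TestFn) (h : ∀ s, 0 ≤ s → φ s = 0) {t : ℝ}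
    (ht : 0 ≤ t) : conv₀ φ ψ t = 0 := by
  simp only [conv₀_apply, conv₀Fun]
  rw [intervalIntegral.integral_of_le ht]
  refine setIntegral_eq_zero_of_forall_eq_zero fun s hs => ?_
  rw [h _ (sub_nonneg.2 hs.2), zero_mul]

theorem SupportedIn.conv₀ {b : ℝ} {φ ψ : TestFn} (hφ : SupportedIn b φ) (hψ : SupportedIn b ψ) :
    SupportedIn (2 * b) (conv₀ φ ψ) := by
  intro t ht
  have : ∀ s, φ (t - s) * ψ s = 0 := by
    intro s
    by_cases hs : b < |s|
    · rw [hψ s hs, mul_zero]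
    · rw [hφ _ (by linarith [abs_sub_abs_le_abs_sub t s]), zero_mul]
  simp [conv₀Fun, this]

theorem supNorm_conv₀_le {b : ℝ} (hb : 0 ≤ b) (φ : TestFn) {ψ : TestFn} (hψ : SupportedIn b ψ) :
    supNorm (conv₀ φ ψ) ≤ 2 * b * (supNorm φ * supNorm ψ) := by
  refine supNorm_le fun t => ?_
  have hi : Integrable ((Icc (-b) b).indicator fun _ : ℝ => supNorm φ * supNorm ψ) := by
    rw [integrable_indicator_iff measurableSet_Icc]
    exact integrableOn_const (by simp)
  have hle : ∀ s, ‖φ (t - s) * ψ s‖ ≤ (Icc (-b) b).indicator (fun _ => supNorm φ * supNorm ψ) s := by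
    intro s
    by_cases hs : |s| ≤ b
    · rw [indicator_of_mem (show s ∈ Icc (-b) b from abs_le.1 hs), norm_mul]
      exact mul_le_mul (norm_apply_le_supNorm _ _) (norm_apply_le_supNorm _ _) (norm_nonneg _)
        (supNorm_nonneg _)
    · rw [hψ s (not_le.1 hs), mul_zero, norm_zero]
      exact indicator_nonneg (fun _ _ => mul_nonneg (supNorm_nonneg _) (supNorm_nonneg _)) _
  rw [conv₀_apply, conv₀Fun]
  calc ‖∫ s in (0 : ℝ)..t, φ (t - s) * ψ s‖
      ≤ ∫ s in uIoc 0 t, ‖φ (t - s) * ψ s‖ := intervalIntegral.norm_integral_le_integral_norm_uIoc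
    _ ≤ ∫ s in uIoc 0 t, (Icc (-b) b).indicator (fun _ => supNorm φ * supNorm ψ) s :=
        integral_mono_of_nonneg (Eventually.of_forall fun _ => norm_nonneg _) hi.integrableOn
          (Eventually.of_forall hle)
    _ ≤ ∫ s, (Icc (-b) b).indicator (fun _ => supNorm φ * supNorm ψ) s :=
        setIntegral_le_integral hi (Eventually.of_forall fun s => (norm_nonneg _).trans (hle s))
    _ = 2 * b * (supNorm φ * supNorm ψ) := by
        rw [integral_indicator measurableSet_Icc, setIntegral_const, measureReal_def,
          Real.volume_Icc, ENNReal.toReal_ofReal (by linarith), smul_eq_mul]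
        ring

/-- The norm `∑_{j ≤ k} sup |φ^{(j)}|`. -/
def ckNorm (k : ℕ) (φ : TestFn) : ℝ := ∑ j ∈ Finset.range (k + 1), supNorm (derivTest^[j] φ)

theorem ckNorm_nonneg (k : ℕ) (φ : TestFn) : 0 ≤ ckNorm k φ :=
  Finset.sum_nonneg fun _ _ => supNorm_nonneg _

theorem supNorm_iterate_le_ckNorm {j k : ℕ} (hjk : j ≤ k) (φ : TestFn) :
    supNorm (derivTest^[j] φ) ≤ ckNorm k φ :=
  Finset.single_le_sum (f := fun j => supNorm (derivTest^[j] φ)) (fun _ _ => supNorm_nonneg _)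
    (Finset.mem_range.2 (Nat.lt_succ_of_le hjk))

theorem ckNorm_derivTest_le (k : ℕ) (φ : TestFn) : ckNorm k (derivTest φ) ≤ ckNorm (k + 1) φ := by
  rw [ckNorm, ckNorm, Finset.sum_range_succ' _ (k + 1)]
  exact le_add_of_nonneg_right (supNorm_nonneg _)

theorem ckNorm_mono {k l : ℕ} (h : k ≤ l) (φ : TestFn) : ckNorm k φ ≤ ckNorm l φ :=
  Finset.sum_le_sum_of_subset_of_nonneg (Finset.range_mono (Nat.succ_le_succ h))
    fun _ _ _ => supNorm_nonneg _

/-- Each derivative contributes one boundary term, whence the summand `k` beside the length `2 * b`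
of the support. -/
theorem supNorm_iterate_conv₀_le {b : ℝ} (hb : 0 ≤ b) (k : ℕ) (φ : TestFn) {ψ : TestFn}
    (hψ : SupportedIn b ψ) :
    supNorm (derivTest^[k] (conv₀ φ ψ)) ≤ (2 * b + k) * (ckNorm k φ * ckNorm k ψ) := by
  induction k generalizing φ with
  | zero =>
    simpa [ckNorm] using supNorm_conv₀_le hb φ hψ
  | succ k ih =>
    rw [Function.iterate_succ_apply, derivTest_conv₀_left, iterate_derivTest_add,
      iterate_derivTest_smul]
    have h1 := ih (derivTest φ)
    have h2 := ckNorm_derivTest_le k φ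
    have h3 := ckNorm_mono (Nat.le_succ k) ψ
    have h4 : ‖φ 0‖ ≤ ckNorm (k + 1) φ :=
      (norm_apply_le_supNorm φ 0).trans (supNorm_iterate_le_ckNorm (Nat.zero_le (k + 1)) φ)
    have h5 := supNorm_iterate_le_ckNorm (Nat.le_succ k) ψ
    have h6 : ckNorm k (derivTest φ) * ckNorm k ψ ≤ ckNorm (k + 1) φ * ckNorm (k + 1) ψ :=
      mul_le_mul h2 h3 (ckNorm_nonneg _ _) (ckNorm_nonneg _ _)
    have h7 : ‖φ 0‖ * supNorm (derivTest^[k] ψ) ≤ ckNorm (k + 1) φ * ckNorm (k + 1) ψ :=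
      mul_le_mul h4 h5 (supNorm_nonneg _) (ckNorm_nonneg _ _)
    calc _ ≤ supNorm (derivTest^[k] (conv₀ (derivTest φ) ψ)) +
          supNorm (φ 0 • derivTest^[k] ψ) := supNorm_add_le _ _
      _ ≤ (2 * b + k) * (ckNorm (k + 1) φ * ckNorm (k + 1) ψ) +
          ckNorm (k + 1) φ * ckNorm (k + 1) ψ := by
        rw [supNorm_smul]
        exact add_le_add (h1.trans (by gcongr)) h7
      _ = _ := by
        push_cast
        ring

end ConvolutionAlgebra

/-! ### Translations and their Taylor remainders. -/

section Translation

/-- The translate `t ↦ φ (t + h)`. -/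
def shiftTest (h : ℝ) (φ : TestFn) : TestFn where
  toFun := fun t => φ (t + h)
  contDiff' := φ.contDiff.comp (contDiff_id.add contDiff_const)
  hasCompactSupport' := φ.hasCompactSupport.comp_homeomorph (Homeomorph.addRight h)
  tsupport_subset' := fun _ _ => trivial

@[simp] theorem shiftTest_apply (h : ℝ) (φ : TestFn) (t : ℝ) : shiftTest h φ t = φ (t + h) := rfl

theorem shiftTest_shiftTest (h k : ℝ) (φ : TestFn) :
    shiftTest h (shiftTest k φ) = shiftTest (h + k) φ := by
  ext t
  simp [add_assoc]

theorem shiftTest_zero (φ : TestFn) : shiftTest 0 φ = φ := by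
  ext t
  simp

theorem iterate_derivTest_shiftTest (n : ℕ) (h : ℝ) (φ : TestFn) :
    derivTest^[n] (shiftTest h φ) = shiftTest h (derivTest^[n] φ) := by
  have : Function.Commute derivTest (shiftTest h) := fun φ => by
    ext t
    exact deriv_comp_add_const (φ : ℝ → ℂ) h t
  exact (this.iterate_left n) φ

theorem supNorm_shiftTest_le (h : ℝ) (φ : TestFn) : supNorm (shiftTest h φ) ≤ supNorm φ :=
  supNorm_le fun _ => norm_apply_le_supNorm φ _

theorem ckNorm_shiftTest_le (k : ℕ) (h : ℝ) (φ : TestFn) : ckNorm k (shiftTest h φ) ≤ ckNorm k φ :=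
  Finset.sum_le_sum fun j _ => by
    rw [iterate_derivTest_shiftTest]
    exact supNorm_shiftTest_le _ _

theorem SupportedIn.shiftTest {b c h : ℝ} {φ : TestFn} (hφ : SupportedIn b φ) (hc : b + |h| ≤ c) :
    SupportedIn c (shiftTest h φ) := fun s hs =>
  hφ _ (by
    have := abs_sub_abs_le_abs_sub s (-h)
    rw [abs_neg, sub_neg_eq_add] at this
    linarith)

/-- The mean value inequality is used twice. Only the quadratic order in `h` matters later, so the
factor `1/2` is given away. -/
theorem supNorm_taylor_le {h : ℝ} (hh : 0 ≤ h) (φ : TestFn) :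
    supNorm (shiftTest h φ - φ - (h : ℂ) • derivTest φ) ≤ h ^ 2 * supNorm (derivTest^[2] φ) := by
  refine supNorm_le fun t => ?_
  have h1 : ∀ s, t ≤ s → ‖derivTest φ s - derivTest φ t‖ ≤ supNorm (derivTest^[2] φ) * (s - t) := by
    intro s hs
    have := convex_univ.norm_image_sub_le_of_norm_hasDerivWithin_le (f := derivTest φ)
      (f' := derivTest^[2] φ) (C := supNorm (derivTest^[2] φ)) (x := t) (y := s)
      (fun u _ => (hasDerivAt_testFn (derivTest φ) u).hasDerivWithinAt)
      (fun u _ => norm_apply_le_supNorm _ u) (mem_univ _) (mem_univ _)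
    rwa [Real.norm_of_nonneg (sub_nonneg.2 hs)] at this
  have h2 := (convex_Icc t (t + h)).norm_image_sub_le_of_norm_hasDerivWithin_le
    (f := fun s : ℝ => φ s - (s : ℂ) * derivTest φ t) (f' := fun s => derivTest φ s - derivTest φ t)
    (C := supNorm (derivTest^[2] φ) * h) (x := t) (y := t + h)
    (fun u _ => by
      have e := (hasDerivAt_testFn φ u).sub ((hasDerivAt_id u).ofReal_comp.mul_const (derivTest φ t))
      refine (e.congr_deriv ?_).hasDerivWithinAt
      simp)
    (fun u hu => (h1 u hu.1).trans (by
      have := supNorm_nonneg (derivTest^[2] φ)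
      gcongr
      linarith [hu.2])) ⟨le_rfl, by linarith⟩ ⟨by linarith, le_rfl⟩
  rw [add_sub_cancel_left, Real.norm_of_nonneg hh] at h2
  change ‖φ (t + h) - φ t - (h : ℂ) * derivTest φ t‖ ≤ _
  refine (le_of_eq ?_).trans (h2.trans_eq (by ring))
  congr 1
  push_cast
  ring

theorem ckNorm_taylor_le (k : ℕ) {h : ℝ} (hh : 0 ≤ h) (φ : TestFn) :
    ckNorm k (shiftTest h φ - φ - (h : ℂ) • derivTest φ) ≤ h ^ 2 * ckNorm (k + 2) φ := by
  have e : ∀ j, supNorm (derivTest^[j] (shiftTest h φ - φ - (h : ℂ) • derivTest φ)) ≤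
      h ^ 2 * supNorm (derivTest^[j + 2] φ) := by
    intro j
    rw [iterate_derivTest_sub, iterate_derivTest_sub, iterate_derivTest_smul,
      iterate_derivTest_shiftTest, ← Function.iterate_succ_apply, Function.iterate_succ_apply']
    refine (supNorm_taylor_le hh _).trans_eq ?_
    rw [← Function.iterate_add_apply, add_comm 2 j]
  rw [ckNorm, ckNorm, Finset.sum_range_succ' _ (k + 2), Finset.sum_range_succ' _ (k + 1)]
  refine (Finset.sum_le_sum fun j _ => e j).trans ?_
  rw [← Finset.mul_sum]
  have h1 := supNorm_nonneg (derivTest^[0] φ)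
  have h2 := supNorm_nonneg (derivTest^[0 + 1] φ)
  gcongr
  linarith

end Translation

/-! ### Vanishing of translation invariant bilinear forms. -/

section Bilinear

variable {E : Type*} [AddCommGroup E] [Module ℂ E]

/-- A form which satisfies `B(φ', ψ) = B(φ, ψ')` and only sees `φ` on `[0, ∞)` vanishes. -/
theorem bilinear_eq_zero (p : Seminorm ℂ E) (B : TestFn →ₗ[ℂ] TestFn →ₗ[ℂ] E) (n : ℕ)
    (hderiv : ∀ φ ψ, B (derivTest φ) ψ = B φ (derivTest ψ))
    (hzero : ∀ φ ψ, (∀ s, 0 ≤ s → φ s = 0) → B φ ψ = 0)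
    (hbound : ∀ b : ℝ, 0 ≤ b → ∃ K, 0 ≤ K ∧ ∀ φ ψ, SupportedIn b φ → SupportedIn b ψ →
      p (B φ ψ) ≤ K * (ckNorm n φ * ckNorm n ψ)) (φ ψ : TestFn) : p (B φ ψ) = 0 := by
  obtain ⟨b₁, hb₁, hφ⟩ := exists_supportedIn φ
  obtain ⟨b₂, hb₂, hψ⟩ := exists_supportedIn ψ
  set b := max b₁ b₂ with hb
  have hb0 : 0 ≤ b := le_max_of_le_left hb₁
  replace hφ : SupportedIn b φ := hφ.mono (le_max_left _ _)
  replace hψ : SupportedIn b ψ := hψ.mono (le_max_right _ _)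
  -- Translation by `R` moves the support of `φ` strictly to the left of 0.
  set R := b + 1 with hR
  have hR0 : 0 < R := by linarith
  -- A translation by at most `R` and then a step of at most `R` enlarge the support by at most `2 *
  -- R`, so one constant serves throughout.
  obtain ⟨K, hK, hKb⟩ := hbound (b + 2 * R) (by linarith)
  set K' := K * (ckNorm (n + 2) φ * ckNorm n ψ + ckNorm n φ * ckNorm (n + 2) ψ) with hK'
  have step : ∀ {h r r' : ℝ}, 0 ≤ h → h ≤ R → |r| ≤ R → |r'| ≤ R →
      p (B (shiftTest h (shiftTest r φ)) (shiftTest r' ψ) -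
        B (shiftTest r φ) (shiftTest h (shiftTest r' ψ))) ≤ h ^ 2 * K' := by
    intro h r r' hh hhR hr hr'
    set φ' := shiftTest r φ with hφ'
    set ψ' := shiftTest r' ψ with hψ'
    have s1 : SupportedIn (b + R) φ' := hφ.shiftTest (by linarith)
    have s2 : SupportedIn (b + R) ψ' := hψ.shiftTest (by linarith)
    have t1 : SupportedIn (b + 2 * R) (shiftTest h φ' - φ' - (h : ℂ) • derivTest φ') :=
      ((s1.shiftTest (by rw [abs_of_nonneg hh]; linarith)).sub (s1.mono (by linarith))).sub
        ((s1.derivTest.mono (by linarith)).smul _)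
    have t2 : SupportedIn (b + 2 * R) (shiftTest h ψ' - ψ' - (h : ℂ) • derivTest ψ') :=
      ((s2.shiftTest (by rw [abs_of_nonneg hh]; linarith)).sub (s2.mono (by linarith))).sub
        ((s2.derivTest.mono (by linarith)).smul _)
    -- The terms of order 0 cancel, and those of order 1 cancel by `hderiv`; only the quadratic
    -- remainders survive.
    have e : B (shiftTest h φ') ψ' - B φ' (shiftTest h ψ') =
        B (shiftTest h φ' - φ' - (h : ℂ) • derivTest φ') ψ' -
        B φ' (shiftTest h ψ' - ψ' - (h : ℂ) • derivTest ψ') := by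
      simp only [map_sub, map_smul, LinearMap.sub_apply, LinearMap.smul_apply, hderiv]
      abel
    rw [e]
    have b1 := hKb _ _ t1 (s2.mono (by linarith))
    have b2 := hKb _ _ (s1.mono (by linarith)) t2
    have n1 := ckNorm_taylor_le n hh φ'
    have n2 := ckNorm_taylor_le n hh ψ'
    have n3 := ckNorm_shiftTest_le n r φ
    have n4 := ckNorm_shiftTest_le n r' ψ
    have n5 := ckNorm_shiftTest_le (n + 2) r φ
    have n6 := ckNorm_shiftTest_le (n + 2) r' ψ
    have p1 : ckNorm n (shiftTest h φ' - φ' - (h : ℂ) • derivTest φ') * ckNorm n ψ' ≤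
        (h ^ 2 * ckNorm (n + 2) φ) * ckNorm n ψ :=
      mul_le_mul (n1.trans (by gcongr)) n4 (ckNorm_nonneg _ _)
        (mul_nonneg (sq_nonneg _) (ckNorm_nonneg _ _))
    have p2 : ckNorm n φ' * ckNorm n (shiftTest h ψ' - ψ' - (h : ℂ) • derivTest ψ') ≤
        ckNorm n φ * (h ^ 2 * ckNorm (n + 2) ψ) :=
      mul_le_mul n3 (n2.trans (by gcongr)) (ckNorm_nonneg _ _) (ckNorm_nonneg _ _)
    calc _ ≤ p (B (shiftTest h φ' - φ' - (h : ℂ) • derivTest φ') ψ') +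
          p (B φ' (shiftTest h ψ' - ψ' - (h : ℂ) • derivTest ψ')) := map_sub_le_add p _ _
      _ ≤ K * ((h ^ 2 * ckNorm (n + 2) φ) * ckNorm n ψ) +
          K * (ckNorm n φ * (h ^ 2 * ckNorm (n + 2) ψ)) :=
        add_le_add (b1.trans (by gcongr)) (b2.trans (by gcongr))
      _ = h ^ 2 * K' := by rw [hK']; ring
  have main : ∀ m : ℕ, p (B φ ψ) ≤ R ^ 2 * K' * (1 / ((m : ℝ) + 1)) := by
    intro m
    -- The distance `R` is covered in `m + 1` steps with error `O(h^2)` each, so the total error is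
    -- `O(1/(m + 1))`.
    set h := R / ((m : ℝ) + 1) with hh
    have hm : (0 : ℝ) < (m : ℝ) + 1 := by positivity
    have hh0 : 0 ≤ h := by positivity
    have hmul : ((m : ℝ) + 1) * h = R := by rw [hh]; field_simp
    have tele : ∀ k : ℕ, k ≤ m + 1 →
        p (B φ ψ - B (shiftTest (k * h) φ) (shiftTest (-(k * h)) ψ)) ≤ k * (h ^ 2 * K') := by
      intro k
      induction k with
      | zero => simp [shiftTest_zero]
      | succ k ih =>
        intro hk
        have hk' : ((k : ℝ) + 1) * h ≤ R := by
          rw [← hmul]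
          gcongr
          exact_mod_cast (by omega : k ≤ m)
        have hkh : 0 ≤ (k : ℝ) * h := by positivity
        have hs := step (h := h) (r := k * h) (r' := -((k + 1) * h)) hh0 (by nlinarith)
          (by rw [abs_of_nonneg hkh]; linarith)
          (by rw [abs_neg, abs_of_nonneg (by positivity)]; exact hk')
        rw [shiftTest_shiftTest, shiftTest_shiftTest, show h + k * h = (k + 1) * h by ring,
          show h + -((k + 1) * h) = -(k * h) by ring] at hs
        push_cast
        calc _ = p ((B φ ψ - B (shiftTest (k * h) φ) (shiftTest (-(k * h)) ψ)) -
              (B (shiftTest ((k + 1) * h) φ) (shiftTest (-((k + 1) * h)) ψ) -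
                B (shiftTest (k * h) φ) (shiftTest (-(k * h)) ψ))) := by
              congr 1
              abel
          _ ≤ k * (h ^ 2 * K') + h ^ 2 * K' :=
              (map_sub_le_add p _ _).trans (add_le_add (ih (by omega)) hs)
          _ = _ := by ring
    have h1 := tele (m + 1) le_rfl
    push_cast at h1
    rw [hmul, hzero (shiftTest R φ) _ fun s hs => hφ _ (by
      rw [abs_of_nonneg (by linarith)]; linarith), sub_zero] at h1
    refine h1.trans_eq ?_
    rw [← hmul]
    field_simp
  refine le_antisymm ?_ (apply_nonneg p _)
  have hlim : Tendsto (fun m : ℕ => R ^ 2 * K' * (1 / ((m : ℝ) + 1))) atTop (𝓝 0) := by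
    simpa using tendsto_one_div_add_atTop_nhds_zero_nat.const_mul (R ^ 2 * K')
  exact ge_of_tendsto' hlim main

end Bilinear

/-! ### The convolution law for `G`. -/

section ConvolutionProperty

variable {E : Type*} [AddCommGroup E] [Module ℂ E] [UniformSpace E] [IsUniformAddGroup E]
  [ContinuousSMul ℂ E] [PolynormableSpace ℂ E] [T2Space E] {C : E →L[ℂ] E} {S : ℝ → E →L[ℂ] E}
  {α : ℝ} {A : E →ₗ.[ℂ] E} {G : TestFn →L[ℂ] E →L[ℂ] E}

theorem distribution_conv (hα : 0 ≤ α)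
    (hG : ∀ (φ : TestFn) x, HasIntegralOn (fun t => weylDeriv α φ t • S t x) (Ioi 0) (G φ x))
    (hA : IsSubgenerator C α S A) (hS : ExpBounded S) (φ ψ : TestFn) (x : E) :
    G (conv₀ φ ψ) (C x) = G φ (G ψ x) := by
  let B : TestFn →ₗ[ℂ] TestFn →ₗ[ℂ] E :=
    LinearMap.mk₂ ℂ (fun φ ψ => G (conv₀ φ ψ) (C x) - G φ (G ψ x))
      (fun φ φ' ψ => by
        simp only [conv₀_add_left, map_add, add_apply]
        abel)
      (fun c φ ψ => by
        simp only [conv₀_smul_left, map_smul, smul_apply, smul_sub])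
      (fun φ ψ ψ' => by
        simp only [conv₀_add_right, map_add, add_apply]
        abel)
      (fun c φ ψ => by
        simp only [conv₀_smul_right, map_smul, smul_apply, smul_sub])
  have hB : ∀ φ ψ, B φ ψ = G (conv₀ φ ψ) (C x) - G φ (G ψ x) := fun _ _ => rfl
  rw [← sub_eq_zero, ← hB]
  refine eq_zero_of_seminorm_eq_zero fun p hp => bilinear_eq_zero p B ⌈α⌉₊ ?_ ?_ ?_ φ ψ
  · intro φ ψ
    -- `A G(φ)G(ψ)x` is computed in two ways, with the derivative falling on `φ` or on `ψ`. The
    -- boundary terms match those of the Leibniz rule for `φ *₀ ψ`, so they cancel in `B`.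
    have h1 := distribution_mem_graph hα hG hA φ (G ψ x)
    have h2 := distribution_comm_graph hG hA φ (distribution_mem_graph hα hG hA ψ x)
    have h3 := A.mem_graph_snd_inj h1 h2 rfl
    have h4 : G (conv₀ (derivTest φ) ψ + φ 0 • ψ) (C x) =
        G (conv₀ φ (derivTest ψ) + ψ 0 • φ) (C x) := by
      rw [← derivTest_conv₀_left, ← derivTest_conv₀_right]
    simp only [map_add, map_smul, add_apply, smul_apply, map_sub, map_neg,
      ← distribution_comm hG hA] at h3 h4
    rw [hB, hB]
    have e1 : G (derivTest φ) (G ψ x) =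
        G φ (G (derivTest ψ) x) + ψ 0 • G φ (C x) - φ 0 • G ψ (C x) := by
      rw [← sub_eq_zero] at h3 ⊢
      rw [← neg_eq_zero, ← h3]
      abel
    have e2 : G (conv₀ (derivTest φ) ψ) (C x) =
        G (conv₀ φ (derivTest ψ)) (C x) + ψ 0 • G φ (C x) - φ 0 • G ψ (C x) :=
      eq_sub_of_add_eq h4
    rw [e1, e2]
    abel
  · intro φ ψ h
    rw [hB, distribution_eq_zero_of_Ici hG hS h,
      distribution_eq_zero_of_Ici hG hS fun s hs => conv₀_eq_zero_of_Ici ψ h hs]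
    simp
  · intro b hb
    obtain ⟨q, hq, hle⟩ := exists_seminorm_distribution_le hG hS hp b
    obtain ⟨q', hq', hle'⟩ := exists_seminorm_distribution_le hG hS hq b
    obtain ⟨r, hr, hler⟩ := exists_seminorm_distribution_le hG hS hp (2 * b)
    have hr0 := apply_nonneg r (C x)
    have hq0 := apply_nonneg q' x
    refine ⟨(2 * b + ⌈α⌉₊) * r (C x) + q' x, by positivity, fun φ ψ hφ hψ => ?_⟩
    have h1 := hler _ (hφ.conv₀ hψ) (C x)
    have h2 := supNorm_iterate_conv₀_le hb ⌈α⌉₊ φ hψ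
    have h3 := hle φ hφ (G ψ x)
    have h4 := hle' ψ hψ x
    have h5 := supNorm_iterate_le_ckNorm (le_refl ⌈α⌉₊) φ
    have h6 := supNorm_iterate_le_ckNorm (le_refl ⌈α⌉₊) ψ
    have n1 := ckNorm_nonneg ⌈α⌉₊ φ
    have n2 := ckNorm_nonneg ⌈α⌉₊ ψ
    calc p (B φ ψ) ≤ p (G (conv₀ φ ψ) (C x)) + p (G φ (G ψ x)) := map_sub_le_add p _ _
      _ ≤ (2 * b + ⌈α⌉₊) * (ckNorm ⌈α⌉₊ φ * ckNorm ⌈α⌉₊ ψ) * r (C x) +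
          ckNorm ⌈α⌉₊ φ * (ckNorm ⌈α⌉₊ ψ * q' x) := by
        refine add_le_add (h1.trans (by gcongr)) (h3.trans ?_)
        exact mul_le_mul h5 (h4.trans (by gcongr)) (apply_nonneg q _) n1
      _ = _ := by ring

end ConvolutionProperty

/-! ### Cutoffs, localised monomials and distributions supported at a point. -/

section Cutoffs

/-- The product of a test function with a smooth function. -/
def mulTest (f : ℝ → ℂ) (hf : ContDiff ℝ (⊤ : ℕ∞) f) (φ : TestFn) : TestFn where
  toFun := fun t => f t * φ t
  contDiff' := hf.mul φ.contDiff
  hasCompactSupport' := φ.hasCompactSupport.mul_left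
  tsupport_subset' := fun _ _ => trivial

theorem mulTest_apply (f : ℝ → ℂ) (hf : ContDiff ℝ (⊤ : ℕ∞) f) (φ : TestFn) (t : ℝ) :
    mulTest f hf φ t = f t * φ t := rfl

theorem mem_TestFn₀_of_eq_zero {φ : TestFn} (h : ∀ s, s < 0 → φ s = 0) : φ ∈ TestFn₀ :=
  closure_minimal (fun s hs => not_lt.1 fun hs' => hs (h s hs')) isClosed_Ici

theorem apply_eq_zero_of_mem_TestFn₀ {φ : TestFn} (hφ : φ ∈ TestFn₀) {s : ℝ} (hs : s < 0) :
    φ s = 0 :=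
  image_eq_zero_of_notMem_tsupport fun h => not_le.2 hs (hφ h)

theorem apply_zero_of_mem_TestFn₀ {φ : TestFn} (hφ : φ ∈ TestFn₀) : φ 0 = 0 := by
  have h1 : Tendsto φ (𝓝[<] 0) (𝓝 (φ 0)) := (φ.continuous.tendsto 0).mono_left nhdsWithin_le_nhds
  have h2 : Tendsto φ (𝓝[<] 0) (𝓝 0) := tendsto_const_nhds.congr' (by
    filter_upwards [self_mem_nhdsWithin] with s hs
    exact (apply_eq_zero_of_mem_TestFn₀ hφ hs).symm)
  exact tendsto_nhds_unique h1 h2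

/-- A smooth step rising from 0 to 1 on `[0, δ]` removes the negative part of `φ`; it differs from 1
on `[0, ∞)` only where `φ` vanishes. -/
theorem exists_mem_TestFn₀_eq {δ : ℝ} (hδ : 0 < δ) {φ : TestFn} (hφ : ∀ s, |s| < δ → φ s = 0) :
    ∃ ψ ∈ TestFn₀, ∀ s, 0 ≤ s → ψ s = φ s := by
  have hf : ContDiff ℝ (⊤ : ℕ∞) fun s : ℝ => ((Real.smoothTransition (s / δ) : ℝ) : ℂ) :=
    Complex.ofRealCLM.contDiff.comp
      (Real.smoothTransition.contDiff.comp (contDiff_id.div_const δ))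
  refine ⟨mulTest _ hf φ, mem_TestFn₀_of_eq_zero fun s hs => ?_, fun s hs => ?_⟩
  · rw [mulTest_apply, Real.smoothTransition.zero_of_nonpos
      (div_nonpos_of_nonpos_of_nonneg hs.le hδ.le), Complex.ofReal_zero, zero_mul]
  · rw [mulTest_apply]
    rcases lt_or_ge s δ with h | h
    · rw [hφ s (by rwa [abs_of_nonneg hs]), mul_zero]
    · rw [Real.smoothTransition.one_of_one_le ((one_le_div hδ).2 h), Complex.ofReal_one, one_mul]

/-- A bump function on the line, equal to `1` on `[-1, 1]`. -/
def realBump : ContDiffBump (0 : ℝ) := ⟨1, 2, one_pos, one_lt_two⟩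

/-- A test function which equals `1` on `[-1, 1]`. -/
def bumpTest : TestFn where
  toFun := fun t => ((realBump t : ℝ) : ℂ)
  contDiff' := Complex.ofRealCLM.contDiff.comp realBump.contDiff
  hasCompactSupport' := realBump.hasCompactSupport.comp_left Complex.ofReal_zero
  tsupport_subset' := fun _ _ => trivial

theorem bumpTest_eq_one {t : ℝ} (ht : |t| ≤ 1) : bumpTest t = 1 := by
  change ((realBump t : ℝ) : ℂ) = 1
  rw [realBump.one_of_mem_closedBall (by simpa [realBump] using ht), Complex.ofReal_one]

/-- A test function which equals `t ^ k` on `[-1, 1]`. -/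
def monomialTest (k : ℕ) : TestFn :=
  mulTest (fun t => (t : ℂ) ^ k) (Complex.ofRealCLM.contDiff.pow k) bumpTest

theorem monomialTest_apply (k : ℕ) (t : ℝ) : monomialTest k t = (t : ℂ) ^ k * bumpTest t := rfl

theorem monomialTest_eq {k : ℕ} {t : ℝ} (ht : |t| ≤ 1) : monomialTest k t = (t : ℂ) ^ k := by
  rw [monomialTest_apply, bumpTest_eq_one ht, mul_one]

theorem derivTest_monomialTest_eq {k : ℕ} {t : ℝ} (ht : |t| < 1) :
    derivTest (monomialTest k) t = k * (t : ℂ) ^ (k - 1) := by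
  -- For `k = 0` the truncated exponent `k - 1` is harmless, as the factor `k` is 0.
  have h1 : (monomialTest k : ℝ → ℂ) =ᶠ[𝓝 t] fun s => (s : ℂ) ^ k := by
    filter_upwards [(isOpen_lt continuous_abs continuous_const).mem_nhds ht] with s hs
    exact monomialTest_eq (le_of_lt hs)
  have h2 : HasDerivAt (fun s : ℝ => (s : ℂ) ^ k) (k * (t : ℂ) ^ (k - 1)) t := by
    simpa using (hasDerivAt_pow k (t : ℂ)).comp_ofReal
  rw [derivTest_apply, h1.deriv_eq, h2.deriv]

/-- The dilate `t ↦ φ (m t)`. -/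
def scaleTest (m : ℝ) (hm : m ≠ 0) (φ : TestFn) : TestFn where
  toFun := fun t => φ (m * t)
  contDiff' := φ.contDiff.comp (contDiff_const.mul contDiff_id)
  hasCompactSupport' := φ.hasCompactSupport.comp_homeomorph (Homeomorph.mulLeft₀ m hm)
  tsupport_subset' := fun _ _ => trivial

theorem derivTest_scaleTest (m : ℝ) (hm : m ≠ 0) (φ : TestFn) :
    derivTest (scaleTest m hm φ) = (m : ℂ) • scaleTest m hm (derivTest φ) := by
  ext t
  have h1 : HasDerivAt (fun u => φ (m * u)) (m • derivTest φ (m * t)) t := by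
    have := (hasDerivAt_testFn φ (m * t)).scomp t ((hasDerivAt_id t).const_mul m)
    rwa [mul_one] at this
  rw [Complex.coe_smul]
  exact h1.deriv

theorem iterate_derivTest_scaleTest (j : ℕ) (m : ℝ) (hm : m ≠ 0) (φ : TestFn) :
    derivTest^[j] (scaleTest m hm φ) = (m : ℂ) ^ j • scaleTest m hm (derivTest^[j] φ) := by
  induction j generalizing φ with
  | zero => simp
  | succ j ih =>
    rw [Function.iterate_succ_apply, derivTest_scaleTest, iterate_derivTest_smul, ih, smul_smul,
      ← pow_succ', Function.iterate_succ_apply]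

theorem ckNorm_scaleTest_le (n : ℕ) {m : ℝ} (hm : 1 ≤ m) (φ : TestFn) :
    ckNorm n (scaleTest m (by positivity) φ) ≤ m ^ n * ckNorm n φ := by
  rw [ckNorm, ckNorm, Finset.mul_sum]
  refine Finset.sum_le_sum fun j hj => ?_
  rw [iterate_derivTest_scaleTest, supNorm_smul, norm_pow, Complex.norm_real,
    Real.norm_of_nonneg (by linarith)]
  exact mul_le_mul (pow_le_pow_right₀ hm (Nat.lt_succ_iff.1 (Finset.mem_range.1 hj)))
    (supNorm_le fun t => norm_apply_le_supNorm (derivTest^[j] φ) (m * t)) (supNorm_nonneg _) (by positivity)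

theorem SupportedIn.scaleTest {b m : ℝ} {φ : TestFn} (h : SupportedIn b φ) (hm : 1 ≤ m) :
    SupportedIn b (scaleTest m (by positivity) φ) := fun s hs => by
  refine h _ (hs.trans_le ?_)
  rw [abs_mul, abs_of_nonneg (by linarith : (0 : ℝ) ≤ m)]
  exact le_mul_of_one_le_left (abs_nonneg s) hm

/-- A distribution of order `n` supported at the origin annihilates `t ^ k`, `k > n`. -/
theorem eq_zero_monomialTest {E : Type*} [AddCommGroup E] [Module ℂ E] (p : Seminorm ℂ E)
    (v : TestFn →ₗ[ℂ] E) {n k : ℕ} (hnk : n < k)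
    (hzero : ∀ δ, 0 < δ → ∀ φ : TestFn, (∀ s, |s| < δ → φ s = 0) → v φ = 0)
    (hbound : ∀ b : ℝ, ∃ K, 0 ≤ K ∧ ∀ φ, SupportedIn b φ → p (v φ) ≤ K * ckNorm n φ) :
    p (v (monomialTest k)) = 0 := by
  obtain ⟨b, -, hb⟩ := exists_supportedIn (monomialTest k)
  obtain ⟨K, hK, hKb⟩ := hbound b
  have main : ∀ i : ℕ, p (v (monomialTest k)) ≤
      K * ckNorm n (monomialTest k) * (1 / ((i : ℝ) + 1)) := by
    intro i
    obtain ⟨m, hmi⟩ : ∃ m : ℝ, m = (i : ℝ) + 1 := ⟨_, rfl⟩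
    have hm : 1 ≤ m := by rw [hmi]; linarith [(Nat.cast_nonneg i : (0 : ℝ) ≤ i)]
    have hm0 : (0 : ℝ) < m := by linarith
    -- Near 0 the dilate equals `m^k` times the localised monomial, so `v` multiplies by `m^k`,
    -- while the order bound allows growth `m^n` only. As `n < k`, letting `m` grow forces the value
    -- 0.
    set ψ := scaleTest m hm0.ne' (monomialTest k) with hψ
    have h1 : v (ψ - (m : ℂ) ^ k • monomialTest k) = 0 := by
      refine hzero (1 / m) (by positivity) _ fun s hs => ?_
      have hs1 : |m * s| ≤ 1 := by
        rw [abs_mul, abs_of_pos hm0]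
        rw [lt_div_iff₀ hm0] at hs
        linarith
      have hs2 : |s| ≤ 1 := hs.le.trans ((div_le_one hm0).2 hm)
      change monomialTest k (m * s) - (m : ℂ) ^ k * monomialTest k s = 0
      rw [monomialTest_eq hs1, monomialTest_eq hs2]
      push_cast
      ring
    rw [map_sub, map_smul, sub_eq_zero] at h1
    have h2 := hKb ψ (hb.scaleTest hm)
    rw [h1, map_smul_eq_mul, norm_pow, Complex.norm_real, Real.norm_of_nonneg hm0.le] at h2
    have h3 := h2.trans (mul_le_mul_of_nonneg_left (ckNorm_scaleTest_le n hm (monomialTest k)) hK)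
    have hN := ckNorm_nonneg n (monomialTest k)
    have h4 : m ^ n * (m * p (v (monomialTest k))) ≤
        m ^ n * (K * ckNorm n (monomialTest k)) := by
      calc _ = m ^ (n + 1) * p (v (monomialTest k)) := by ring
        _ ≤ m ^ k * p (v (monomialTest k)) :=
          mul_le_mul_of_nonneg_right (pow_le_pow_right₀ hm hnk) (apply_nonneg p _)
        _ ≤ _ := h3.trans_eq (by ring)
    have h5 := le_of_mul_le_mul_left h4 (by positivity)
    rw [← hmi, mul_one_div, le_div_iff₀ hm0]
    linarith
  refine le_antisymm ?_ (apply_nonneg p _)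
  have hlim : Tendsto (fun i : ℕ => K * ckNorm n (monomialTest k) * (1 / ((i : ℝ) + 1))) atTop
      (𝓝 0) := by
    simpa using tendsto_one_div_add_atTop_nhds_zero_nat.const_mul (K * ckNorm n (monomialTest k))
  exact ge_of_tendsto' hlim main

end Cutoffs

/-- As `S` commutes with `C`, the equation defining the integral generator at `(Cx, Cy)` is `C`
applied to the one at `(x, y)`, and injectivity cancels `C`. A mere subgenerator would not suffice
here. -/
theorem mem_graph_of_map_mem_graph {E : Type*} [AddCommGroup E] [Module ℂ E] [UniformSpace E]
    [PolynormableSpace ℂ E] [T2Space E] {C : E →L[ℂ] E} {S : ℝ → E →L[ℂ] E} {α : ℝ}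
    {A : E →ₗ.[ℂ] E} (hA : Generates C α S A) (hC : Function.Injective C) {x y : E}
    (hxy : (C x, C y) ∈ A.graph) : (x, y) ∈ A.graph := by
  have h1 : (C x, C y) ∈ semigroupIntegralGenerator C α S := hA.2 ▸ hxy
  change (x, y) ∈ (A.graph : Set (E × E))
  rw [hA.2]
  intro t ht
  obtain ⟨z, hz, -⟩ := hA.1.eq_op t ht y
  have h2 := (hz.map C).congr measurableSet_Ioc (g := fun s => S s (C y))
    fun s hs => (hA.1.comm s hs.1.le y).symm
  have h3 := h2.unique (h1 t ht)
  rw [hA.1.comm t ht, ← map_smul, ← map_sub] at h3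
  rwa [← hC h3]

/-! ### The generator of `G` and the distribution semigroup axioms. -/

section Generator

variable {E : Type*} [AddCommGroup E] [Module ℂ E] [UniformSpace E] [IsUniformAddGroup E]
  [ContinuousSMul ℂ E] {C : E →L[ℂ] E} {S : ℝ → E →L[ℂ] E} {α : ℝ} {A : E →ₗ.[ℂ] E}
  {G : TestFn →L[ℂ] E →L[ℂ] E}

/-- The distribution `φ ↦ -G(φ')x - φ(0) C x - G(φ) y`, which vanishes if `(x, y)` belongs to the
generator. -/
def generatorDefect (C : E →L[ℂ] E) (G : TestFn →L[ℂ] E →L[ℂ] E) (x y : E) : TestFn →ₗ[ℂ] E where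
  toFun φ := -G (derivTest φ) x - φ 0 • C x - G φ y
  map_add' φ ψ := by
    change -G (derivTest (φ + ψ)) x - (φ 0 + ψ 0) • C x - G (φ + ψ) y = _
    rw [derivTest_add, map_add, map_add, add_apply, add_apply, add_smul]
    abel
  map_smul' c φ := by
    change -G (derivTest (c • φ)) x - (c * φ 0) • C x - G (c • φ) y = _
    rw [derivTest_smul, map_smul, map_smul, smul_apply, smul_apply, RingHom.id_apply, smul_sub,
      smul_sub, smul_neg, smul_smul]

theorem generatorDefect_apply (x y : E) (φ : TestFn) :
    generatorDefect C G x y φ = -G (derivTest φ) x - φ 0 • C x - G φ y := rfl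

variable [PolynormableSpace ℂ E]

/-- The key identity for `φ'` at `x` and `φ` at `y`, added. It links the values of the defect at `φ`
and at `φ'`, which drives the descent through the powers of `t`. -/
theorem generatorDefect_mem_graph (hα : 0 ≤ α)
    (hG : ∀ (φ : TestFn) x, HasIntegralOn (fun t => weylDeriv α φ t • S t x) (Ioi 0) (G φ x))
    (hA : IsSubgenerator C α S A) (x y : E) (φ : TestFn) :
    (generatorDefect C G x y φ + φ 0 • C x, -generatorDefect C G x y (derivTest φ) + φ 0 • C y) ∈
      A.graph := by
  have h := A.graph.neg_mem (A.graph.add_mem (distribution_mem_graph hα hG hA (derivTest φ) x)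
    (distribution_mem_graph hα hG hA φ y))
  convert h using 1
  refine Prod.ext ?_ ?_
  · change -G (derivTest φ) x - φ 0 • C x - G φ y + φ 0 • C x = -(G (derivTest φ) x + G φ y)
    abel
  · change -(-G (derivTest (derivTest φ)) x - derivTest φ 0 • C x - G (derivTest φ) y) + φ 0 • C y =
      -((-G (derivTest (derivTest φ)) x - derivTest φ 0 • C x) + (-G (derivTest φ) y - φ 0 • C y))
    abel

theorem exists_generatorDefect_le
    (hG : ∀ (φ : TestFn) x, HasIntegralOn (fun t => weylDeriv α φ t • S t x) (Ioi 0) (G φ x))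
    (hS : ExpBounded S) {p : Seminorm ℂ E} (hp : Continuous p) (x y : E) (b : ℝ) :
    ∃ K, 0 ≤ K ∧ ∀ φ, SupportedIn b φ →
      p (generatorDefect C G x y φ) ≤ K * ckNorm (⌈α⌉₊ + 1) φ := by
  obtain ⟨q, hq, hle⟩ := exists_seminorm_distribution_le hG hS hp b
  refine ⟨q x + p (C x) + q y, by positivity, fun φ hφ => ?_⟩
  have h1 := hle _ hφ.derivTest x
  have h2 := hle φ hφ y
  rw [← Function.iterate_succ_apply] at h1
  have n1 := supNorm_iterate_le_ckNorm (le_refl (⌈α⌉₊ + 1)) φ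
  have n2 := supNorm_iterate_le_ckNorm (Nat.le_succ ⌈α⌉₊) φ
  have n3 := (norm_apply_le_supNorm φ 0).trans
    (supNorm_iterate_le_ckNorm (Nat.zero_le (⌈α⌉₊ + 1)) φ)
  calc p (generatorDefect C G x y φ)
      ≤ p (-G (derivTest φ) x) + p (φ 0 • C x) + p (G φ y) :=
        (map_sub_le_add p _ _).trans (add_le_add_left (map_sub_le_add p _ _) _)
    _ ≤ ckNorm (⌈α⌉₊ + 1) φ * q x + ckNorm (⌈α⌉₊ + 1) φ * p (C x) + ckNorm (⌈α⌉₊ + 1) φ * q y := by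
        rw [map_neg_eq_map, map_smul_eq_mul]
        exact add_le_add (add_le_add
          (h1.trans (mul_le_mul_of_nonneg_right n1 (apply_nonneg q x)))
          (mul_le_mul_of_nonneg_right n3 (apply_nonneg p _)))
          (h2.trans (mul_le_mul_of_nonneg_right n2 (apply_nonneg q y)))
    _ = _ := by ring

variable [T2Space E]

/-- The defect is supported at the origin: away from 0, `φ` may be replaced by a member of `TestFn₀`
that agrees with it on `[0, ∞)`, and there the generator relation applies. -/
theorem generatorDefect_eq_zero
    (hG : ∀ (φ : TestFn) x, HasIntegralOn (fun t => weylDeriv α φ t • S t x) (Ioi 0) (G φ x))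
    (hS : ExpBounded S) {x y : E} (hxy : (x, y) ∈ distributionIntegralGenerator G) {δ : ℝ}
    (hδ : 0 < δ) {φ : TestFn} (hφ : ∀ s, |s| < δ → φ s = 0) : generatorDefect C G x y φ = 0 := by
  obtain ⟨ψ, hψ, hψφ⟩ := exists_mem_TestFn₀_eq hδ hφ
  have hd : ∀ s, 0 ≤ s → (φ - ψ) s = 0 := fun s hs => by
    change φ s - ψ s = 0
    rw [hψφ s hs, sub_self]
  have h1 := distribution_eq_zero_of_Ici hG hS hd
  have h2 := distribution_eq_zero_of_Ici hG hS fun s hs => derivTest_eq_zero_of_Ici hd hs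
  rw [derivTest_sub, map_sub, sub_eq_zero] at h2
  rw [map_sub, sub_eq_zero] at h1
  have h3 : G (-derivTest ψ) x = G ψ y := hxy ψ hψ
  rw [map_neg, neg_apply] at h3
  rw [generatorDefect_apply, h1, h2, h3, hφ 0 (by simpa using hδ), zero_smul, sub_zero, sub_self]

theorem map_mem_graph_of_mem_generator (hα : 0 ≤ α)
    (hG : ∀ (φ : TestFn) x, HasIntegralOn (fun t => weylDeriv α φ t • S t x) (Ioi 0) (G φ x))
    (hA : IsSubgenerator C α S A) (hS : ExpBounded S) {x y : E}
    (hxy : (x, y) ∈ distributionIntegralGenerator G) : (C x, C y) ∈ A.graph := by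
  set v := generatorDefect C G x y with hv
  have hnear : ∀ δ, 0 < δ → ∀ φ : TestFn, (∀ s, |s| < δ → φ s = 0) → v φ = 0 :=
    fun δ hδ φ hφ => generatorDefect_eq_zero hG hS hxy hδ hφ
  -- The defect has order at most `⌈α⌉₊ + 1`, one more than `G`, because it contains `G (φ')`.
  have htop : v (monomialTest (⌈α⌉₊ + 2)) = 0 := eq_zero_of_seminorm_eq_zero fun p hp =>
    eq_zero_monomialTest p v (Nat.lt_succ_self (⌈α⌉₊ + 1)) hnear
      (exists_generatorDefect_le hG hS hp x y)
  have hdescent : ∀ k, v (monomialTest (k + 1)) = 0 → v (monomialTest k) = 0 := by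
    intro k hk
    -- At `t^(k+1)` both `φ(0)` and the defect are 0, so `(0, -v(φ'))` lies in the graph; since `A`
    -- is single valued, `v(φ') = 0`, and near 0 `φ'` is a nonzero multiple of `t^k`.
    have h1 := generatorDefect_mem_graph hα hG hA x y (monomialTest (k + 1))
    rw [← hv, hk, monomialTest_eq (by simp)] at h1
    simp only [Complex.ofReal_zero, ne_eq, Nat.add_eq_zero_iff, one_ne_zero, and_false,
      not_false_eq_true, zero_pow, zero_smul, add_zero] at h1
    have h2 : v (derivTest (monomialTest (k + 1))) = 0 :=
      neg_eq_zero.1 (A.mem_graph_snd_inj h1 A.graph.zero_mem rfl)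
    have h3 := hnear 1 one_pos (derivTest (monomialTest (k + 1)) - ((k + 1 : ℕ) : ℂ) • monomialTest k)
      fun s hs => by
        change derivTest (monomialTest (k + 1)) s - ((k + 1 : ℕ) : ℂ) * monomialTest k s = 0
        rw [derivTest_monomialTest_eq hs, monomialTest_eq hs.le, Nat.add_sub_cancel, sub_self]
    rw [map_sub, map_smul, h2, zero_sub, neg_eq_zero, smul_eq_zero] at h3
    exact h3.resolve_left (by exact_mod_cast Nat.succ_ne_zero k)
  have hall : ∀ k, v (monomialTest k) = 0 → v (monomialTest 0) = 0 := by
    intro k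
    induction k with
    | zero => exact id
    | succ k ih => exact fun h => ih (hdescent k h)
  have h0 := hall _ htop
  have h1 := hnear 1 one_pos (derivTest (monomialTest 0)) fun s hs => by
    rw [derivTest_monomialTest_eq hs, Nat.cast_zero, zero_mul]
  -- For `φ = 1` near 0 both defects vanish and `φ(0) = 1`, which leaves exactly `(Cx, Cy)`.
  have h2 := generatorDefect_mem_graph hα hG hA x y (monomialTest 0)
  rw [← hv, h0, h1, monomialTest_eq (by simp)] at h2
  simpa using h2

theorem distributionIntegralGenerator_eq (hα : 0 ≤ α)
    (hG : ∀ (φ : TestFn) x, HasIntegralOn (fun t => weylDeriv α φ t • S t x) (Ioi 0) (G φ x))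
    (hA : Generates C α S A) (hC : Function.Injective C) (hS : ExpBounded S) :
    distributionIntegralGenerator G = (A.graph : Set (E × E)) := by
  ext ⟨x, y⟩
  constructor
  · exact fun h => mem_graph_of_map_mem_graph hA hC (map_mem_graph_of_mem_generator hα hG hA.1 hS h)
  · intro h φ hφ
    have h1 := distribution_mem_graph hα hG hA.1 φ x
    rw [apply_zero_of_mem_TestFn₀ hφ, zero_smul, sub_zero] at h1
    rw [map_neg, neg_apply]
    exact A.mem_graph_snd_inj h1 (distribution_comm_graph hG hA.1 φ h) rfl

theorem isDistributionSemigroup (hα : 0 ≤ α)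
    (hG : ∀ (φ : TestFn) x, HasIntegralOn (fun t => weylDeriv α φ t • S t x) (Ioi 0) (G φ x))
    (hA : Generates C α S A) (hC : Function.Injective C) (hS : ExpBounded S) :
    IsDistributionSemigroup C G where
  support φ hφ := distribution_eq_zero_of_Ici hG hS fun s hs =>
    image_eq_zero_of_notMem_tsupport fun h => not_lt.2 hs (hφ h)
  comm := distribution_comm hG hA.1
  bddEquicontinuous p hp B hB := by
    obtain ⟨ω, hω, q, hq, hle⟩ := hS p hp
    obtain ⟨M, hM, hMB⟩ := bounded_on_of_isVonNBounded hB (continuous_expSeminorm (ω + 1) ⌈α⌉₊)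
    let c : NNReal := ⟨M * weylMass α (ω + 1), mul_nonneg hM (weylMass_nonneg _ _)⟩
    refine ⟨c • q, continuous_const_smul_seminorm hq c, fun φ hφ x => ?_⟩
    refine seminorm_distribution_le hG hp hω hle (fun s _ => ?_) x
    refine (norm_testFn_le_exp (ω + 1) _ s).trans ?_
    rw [← expSeminorm_apply]
    exact mul_le_mul_of_nonneg_right (hMB φ hφ) (Real.exp_pos _).le
  conv := distribution_conv hα hG hA.1 hS
  nondegenerate x hx := by
    -- A vector killed by all `G φ` with `φ ∈ TestFn₀` is a value of the generator at 0.
    have h : ((0 : E), x) ∈ (A.graph : Set (E × E)) := by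
      rw [← distributionIntegralGenerator_eq hα hG hA hC hS]
      intro φ hφ
      rw [map_zero, hx φ hφ]
    exact A.mem_graph_snd_inj h A.graph.zero_mem rfl

end Generator

open scoped ComplexOrder in
theorem polynormableSpace_of_locallyConvexSpace (E : Type*) [AddCommGroup E] [Module ℂ E]
    [Module ℝ E] [IsScalarTower ℝ ℂ E] [TopologicalSpace E] [IsTopologicalAddGroup E]
    [ContinuousSMul ℂ E] [LocallyConvexSpace ℝ E] : PolynormableSpace ℂ E := by
  have : ContinuousSMul ℝ E := IsScalarTower.continuousSMul ℂ
  have : LocallyConvexSpace ℂ E := LocallyConvexSpace.ofBasisZero ℂ E _ _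
    (LocallyConvexSpace.convex_basis_zero ℝ E) fun s hs =>
      convex_of_nonneg_surjective_algebraMap _
        (fun _ => (RCLike.nonneg_iff_exists_ofReal (K := ℂ)).mp) hs.2
  infer_instance

end CDist

end

theorem theorem2p3 {E : Type*} [AddCommGroup E] [Module ℂ E] [Module ℝ E] [IsScalarTower ℝ ℂ E]
    [UniformSpace E] [IsUniformAddGroup E] [ContinuousSMul ℂ E] [LocallyConvexSpace ℝ E]
    [T2Space E] (hE : CDist.SeqComplete E)
    (C : E →L[ℂ] E) (hC : Function.Injective C)
    (α : ℝ) (hα : 0 ≤ α) (S : ℝ → E →L[ℂ] E) (A : E →ₗ.[ℂ] E)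
    (hA : CDist.Generates C α S A) :
    (CDist.ExpEquicontinuous S →
      ∃ G : CDist.TestFn →L[ℂ] E →L[ℂ] E,
        (∀ (φ : CDist.TestFn) (x : E),
          CDist.HasIntegralOn (fun t => CDist.weylDeriv α φ t • S t x) (Set.Ioi 0) (G φ x)) ∧
        CDist.IsDistributionSemigroup C G ∧
        CDist.IsExponential G ∧
        CDist.distributionIntegralGenerator G = (A.graph : Set (E × E))) ∧
    (CDist.QExpEquicontinuous S →
      ∃ G : CDist.TestFn →L[ℂ] E →L[ℂ] E,
        (∀ (φ : CDist.TestFn) (x : E),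
          CDist.HasIntegralOn (fun t => CDist.weylDeriv α φ t • S t x) (Set.Ioi 0) (G φ x)) ∧
        CDist.IsDistributionSemigroup C G ∧
        CDist.IsQExponential G ∧
        CDist.distributionIntegralGenerator G = (A.graph : Set (E × E))) := by
  have : PolynormableSpace ℂ E := CDist.polynormableSpace_of_locallyConvexSpace E
  constructor
  · intro h
    obtain ⟨G, hG⟩ := CDist.exists_distribution (α := α) hE hA.1.continuousOn h.expBounded
    exact ⟨G, hG, CDist.isDistributionSemigroup hα hG hA hC h.expBounded,
      CDist.isExponential_of_expEquicontinuous hE hA.1.continuousOn hG h,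
      CDist.distributionIntegralGenerator_eq hα hG hA hC h.expBounded⟩
  · intro h
    obtain ⟨G, hG⟩ := CDist.exists_distribution (α := α) hE hA.1.continuousOn h.expBounded
    exact ⟨G, hG, CDist.isDistributionSemigroup hα hG hA hC h.expBounded,
      CDist.isQExponential_of_expBounded hG h.expBounded,
      CDist.distributionIntegralGenerator_eq hα hG hA hC h.expBounded⟩
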